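/- Let $S^{n-1}$ be the unit sphere and $B_2^n$ the unit ball of Euclidean space $\mathbb{R}^n$; write $|B_2^n|$ for the $n$-dimensional volume of $B_2^n$, $|S^{n-1}|$ for the $(n-1)$-dimensional surface area of $S^{n-1}$, $\mathrm{vol}_n$ for $n$-dimensional volume, $[x_1,\dots,x_k]$ for the convex hull of $x_1,\dots,x_k$, $\Gamma(x)=\int_0^\infty s^{x-1}e^{-s}\,ds$ for the Gamma function and $B(x,y)=\int_0^1 s^{x-1}(1-s)^{y-1}\,ds=\Gamma(x)\Gamma(y)/\Gamma(x+y)$ for the Beta function. Let $\xi_1,\dots,\xi_{n+1}$ be independent random points, each uniformly distributed on $S^{n-1}$. (i) For $n=2$, $$\frac{(2t)^{2/3}}{\pi^{8/3}}\le \mathbb{P}\big(\mathrm{vol}_2([\xi_1,\xi_2,\xi_3])\le t\big)\le 342\, t^{2/3},$$ where the left-hand inequality holds for all $t$ with $0\le t\le\pi$ and the right-hand inequality for all $t\ge 0$. (ii) For all $n\ge 3$, $$a_n t\le \mathbb{P}\big(\mathrm{vol}_n([\xi_1,\dots,\xi_{n+1}])\le t\big)\le b_n t,$$ where the left-hand inequality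 holds for all $t$ with $0\le t\le |B_2^n|$ and the right-hand inequality for all $t\ge 0$. The constants are $$a_n=\frac{1}{|B_2^n|}\left(\frac{1}{\sqrt{e}\sqrt{n}}\,\frac{|S^{n-2}|^{n+1}}{n^2|S^{n-1}|^n}\,\frac{\Gamma\big(\frac{(n-1)^2+1}{2}\big)}{\Gamma\big(\frac{(n-1)^2}{2}\big)}\left(\frac{\Gamma(\frac{n-1}{2})}{\Gamma(\frac n2)}\right)^{n-1}\frac{\Gamma(\frac{n-1}{2})}{\Gamma(\frac12)}\right)$$ and $$b_n=\frac{n!\,|S^{n-2}|^{n+1}}{|S^{n-1}|^n}\,B\Big(\frac12,\frac{n^2-3n+2}{2}\Big).$$ -/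

import Mathlib

open MeasureTheory ProbabilityTheory

noncomputable section

/-- The volume of the unit ball `B_2^m` of Euclidean space `ℝ^m`. -/
def ballVol (m : ℕ) : ℝ :=
  (volume : Measure (EuclideanSpace ℝ (Fin m))).real (Metric.ball 0 1)

/-- The surface measure (not normalized) on the unit sphere `S^{m-1}` of Euclidean space `ℝ^m`. -/
def surfaceMeasure (m : ℕ) : Measure (Metric.sphere (0 : EuclideanSpace ℝ (Fin m)) 1) :=
  (volume : Measure (EuclideanSpace ℝ (Fin m))).toSphere

/-- The surface area of the unit sphere of `ℝ^m`: `sphereArea m = |S^{m-1}|`. -/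
def sphereArea (m : ℕ) : ℝ := (surfaceMeasure m).real Set.univ

/-- The uniform distribution on the unit sphere `S^{m-1}` of `ℝ^m`: normalized surface measure. -/
def uniformSphere (m : ℕ) : Measure (Metric.sphere (0 : EuclideanSpace ℝ (Fin m)) 1) :=
  (surfaceMeasure m Set.univ)⁻¹ • surfaceMeasure m

/-- The `n`-dimensional volume of the convex hull `[x_1, …, x_{n+1}]` of `n + 1` points
of the unit sphere of `ℝ^n`. -/
def simplexVol {n : ℕ} (x : Fin (n + 1) → Metric.sphere (0 : EuclideanSpace ℝ (Fin n)) 1) : ℝ :=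
  (volume : Measure (EuclideanSpace ℝ (Fin n))).real
    (convexHull ℝ (Set.range fun i => (x i : EuclideanSpace ℝ (Fin n))))

/-- The constant `a_n`, used for `n ≥ 3`. -/
def lowerConst (n : ℕ) : ℝ :=
  1 / ballVol n *
    (1 / (√(Real.exp 1) * √(n : ℝ)) *
      (sphereArea (n - 1) ^ (n + 1) / ((n : ℝ) ^ 2 * sphereArea n ^ n)) *
      (Real.Gamma ((((n : ℝ) - 1) ^ 2 + 1) / 2) / Real.Gamma (((n : ℝ) - 1) ^ 2 / 2)) *
      (Real.Gamma (((n : ℝ) - 1) / 2) / Real.Gamma ((n : ℝ) / 2)) ^ (n - 1) *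
      (Real.Gamma (((n : ℝ) - 1) / 2) / Real.Gamma (1 / 2)))

/-- The constant `b_n`, used for `n ≥ 3`. -/
def upperConst (n : ℕ) : ℝ :=
  (n.factorial : ℝ) * sphereArea (n - 1) ^ (n + 1) / sphereArea n ^ n *
    ProbabilityTheory.beta (1 / 2) (((n : ℝ) ^ 2 - 3 * (n : ℝ) + 2) / 2)

end

/-!
The volume of the simplex is `|det (x i - y)| / n!`, where `y` is one vertex and `x 1, …, x n` are
the others. Let `X` be the matrix with rows `x i`, almost surely invertible, and let `w` solve
`⟪x i, w⟫ = 1`, so that the hyperplane through the `x i` has normal `w` and distance `1 / ‖w‖` from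
the origin. The matrix determinant lemma gives `|det (x i - y)| = |det X| |1 - ⟪y, w⟫|`. Given the
`x i`, the volume is thus at most `t` when `y` lies in a slab around that hyperplane. The measure of
slabs follows from the density of the height `⟪y, u⟫` along a unit vector `u`, which is
`|S^{n-2}| / |S^{n-1}| (1 - s²)^((n-3)/2)` (`surfaceMeasure_inner_mem`).

*Upper bound, `n ≥ 3`.* The density is at most `γ = |S^{n-2}| / |S^{n-1}|`, so the slab has measure
at most `2 γ n! t / (|det X| ‖w‖)`, and it remains to bound the mean of `1 / (|det X| ‖w‖)`
(`lintegral_one_div_det_mul_norm_le`). This is a Blaschke–Petkantschin formula in disguise, and it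
is obtained from a linear change of variables: for `ε > 0`, the vectors `w'` with
`1 ≤ ⟪x i, w'⟫ ≤ 1 + ε` for all `i` form a box of volume `ε^n / |det X|` that shrinks to `w`, so by
Fatou's lemma it suffices to bound the mean over `X` of `ε^{-n}` times the integral of `1 / ‖w'‖`
over this box. By Fubini's theorem that is the integral over `w'` of `1 / ‖w'‖` times the `n`-th
power of `ε⁻¹ ℙ(1 ≤ ⟪y, w'⟫ ≤ 1 + ε)`. As the box lies on the far side of `w`, the monotonicity of
the density bounds this power independently of `ε`, and polar coordinates turn the integral over
`w'` into a beta integral.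

*Lower bound, `n ≥ 3`.* The vertices `x i` lie in a sphere of radius `ρ = √(1 - ‖w‖⁻²)` in their
hyperplane, so Hadamard's inequality bounds `|det X| ‖w‖` by a multiple of `ρ^{n-1}`. The slab is
therefore the wider the farther the hyperplane is from the centre, which compensates for the
decreasing density: the conditional probability is at least `min (n! t / (2 · 2^{n/2})) (1/2)`
(`le_uniformSphere_slab`). This exceeds `a_n t` by a wide margin.

*The case `n = 2`.* The area of a triangle inscribed in the unit circle is a quarter of the product
of its sides (`simplexVol_two`). Chords from a fixed point are independent, and the probability that
such a chord is at most `r ≤ 2` long lies between `r / π` and `r`. Two short chords from one vertex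
give the lower bound; for the upper bound, the lengths `a ≤ b` of the two shorter sides satisfy
`a b² ≤ 4 t`, and a dyadic decomposition in `a` reduces this to products of independent events.
-/

open Set Metric Module Filter Topology
open scoped ENNReal RealInnerProductSpace Pointwise Nat

/-! ### Integration in polar coordinates and adapted Cartesian coordinates -/

/-- Integration in polar coordinates of a radial function, for the Lebesgue integral. -/
theorem lintegral_fun_norm_addHaar {E : Type*} [NormedAddCommGroup E] [NormedSpace ℝ E]
    [Nontrivial E] [FiniteDimensional ℝ E] [MeasurableSpace E] [BorelSpace E]
    (μ : Measure E) [μ.IsAddHaarMeasure] {f : ℝ → ℝ≥0∞} (hf : Measurable f) :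
    ∫⁻ x, f ‖x‖ ∂μ =
      μ.toSphere univ * ∫⁻ r in Ioi (0 : ℝ), ENNReal.ofReal (r ^ (finrank ℝ E - 1)) * f r := by
  calc
    ∫⁻ x, f ‖x‖ ∂μ = ∫⁻ x : ({(0)}ᶜ : Set E), f ‖x.1‖ ∂(μ.comap (↑)) := by
      rw [lintegral_subtype_comap (measurableSet_singleton _).compl fun x ↦ f ‖x‖,
        restrict_compl_singleton]
    _ = ∫⁻ x, f x.2 ∂μ.toSphere.prod (.volumeIoiPow (finrank ℝ E - 1)) := by
      rw [← μ.measurePreserving_homeomorphUnitSphereProd.lintegral_comp_emb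
        (Homeomorph.measurableEmbedding _)]
      simp
    _ = μ.toSphere univ * ∫⁻ x : Ioi (0 : ℝ), f x ∂.volumeIoiPow (finrank ℝ E - 1) := by
      rw [lintegral_prod _ (by fun_prop)]
      simp [mul_comm]
    _ = _ := by
      rw [Measure.volumeIoiPow, lintegral_withDensity_eq_lintegral_mul₀ (by fun_prop)
        (by fun_prop)]
      congr 1
      rw [← lintegral_subtype_comap measurableSet_Ioi
        fun a ↦ ENNReal.ofReal (a ^ (finrank ℝ E - 1)) * f a]
      rfl

/-- Cartesian coordinates adapted to a unit vector `u`: the first one is the height along `u`, the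
others are the orthogonal part. -/
theorem exists_measurePreserving_height {m : ℕ} {u : EuclideanSpace ℝ (Fin (m + 1))}
    (hu : ‖u‖ = 1) :
    ∃ Φ : EuclideanSpace ℝ (Fin (m + 1)) ≃ᵐ ℝ × EuclideanSpace ℝ (Fin m),
      MeasurePreserving Φ volume volume ∧
        ∀ x, (Φ x).1 = ⟪x, u⟫ ∧ ‖x‖ ^ 2 = (Φ x).1 ^ 2 + ‖(Φ x).2‖ ^ 2 := by
  obtain ⟨b, hb⟩ := Orthonormal.exists_orthonormalBasis_extension_of_card_eq (𝕜 := ℝ)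
    (E := EuclideanSpace ℝ (Fin (m + 1))) (ι := Fin (m + 1)) (by simp)
    (v := fun _ => u) (s := {0}) (by
      rw [orthonormal_iff_ite]
      rintro ⟨i, hi⟩ ⟨j, hj⟩
      simp only [mem_singleton_iff] at hi hj
      subst hi; subst hj
      simp [Set.domRestrict, hu])
  have hb0 : b 0 = u := hb 0 rfl
  let e1 : EuclideanSpace ℝ (Fin (m + 1)) ≃ᵐ EuclideanSpace ℝ (Fin (m + 1)) :=
    b.repr.toHomeomorph.toMeasurableEquiv
  let e2 : EuclideanSpace ℝ (Fin (m + 1)) ≃ᵐ (Fin (m + 1) → ℝ) :=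
    (MeasurableEquiv.toLp 2 _).symm
  let e3 := MeasurableEquiv.piFinSuccAbove (fun _ : Fin (m + 1) => ℝ) 0
  let e4 : ℝ × (Fin m → ℝ) ≃ᵐ ℝ × EuclideanSpace ℝ (Fin m) :=
    (MeasurableEquiv.refl ℝ).prodCongr (MeasurableEquiv.toLp 2 _)
  refine ⟨e1.trans (e2.trans (e3.trans e4)), ?_, ?_⟩
  · have h1 : MeasurePreserving e1 volume volume := b.measurePreserving_repr
    have h2 : MeasurePreserving e2 volume volume := PiLp.volume_preserving_ofLp (Fin (m + 1))
    have h3 : MeasurePreserving e3 volume volume :=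
      volume_preserving_piFinSuccAbove (fun _ : Fin (m + 1) => ℝ) 0
    have h4 : MeasurePreserving e4 volume volume :=
      (MeasurePreserving.id volume).prod (PiLp.volume_preserving_toLp (Fin m))
    exact ((h4.comp h3).comp h2).comp h1
  · intro x
    have hx1 : ∀ y, (e1.trans (e2.trans (e3.trans e4)) y).1 = b.repr y 0 := fun y => rfl
    have hx2 : ∀ y i, (e1.trans (e2.trans (e3.trans e4)) y).2 i = b.repr y (Fin.succ i) :=
      fun y i => rfl
    constructor
    · rw [hx1, b.repr_apply_apply, hb0, real_inner_comm]
    · rw [← b.repr.norm_map, EuclideanSpace.norm_sq_eq, EuclideanSpace.norm_sq_eq, hx1,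
        Fin.sum_univ_succ]
      simp only [hx2, Real.norm_eq_abs, sq_abs]

/-! ### The height of a random point of the sphere -/

/-- The line at distance `ρ` from the origin, parametrized by the cosine `τ` of the angle with its
direction: the point at position `s` has `τ = s / √(s² + ρ²)`, that is `s = ρ τ / √(1 - τ²)`. -/
theorem volume_line_eq_lintegral_cos {ρ : ℝ} (hρ : 0 < ρ) {A : Set ℝ} (hA : MeasurableSet A) :
    volume {s : ℝ | s ^ 2 + ρ ^ 2 < 1 ∧ s / √(s ^ 2 + ρ ^ 2) ∈ A} =
      ∫⁻ τ in A ∩ Ioo (-1) 1, ENNReal.ofReal (ρ / ((1 - τ ^ 2) * √(1 - τ ^ 2))) *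
        (Iio √(1 - τ ^ 2)).indicator 1 ρ := by
  set f : ℝ → ℝ := fun τ => ρ * τ / √(1 - τ ^ 2) with hf
  set B : Set ℝ := {τ | τ ∈ A ∩ Ioo (-1) 1 ∧ ρ < √(1 - τ ^ 2)} with hB
  have hBm : MeasurableSet B :=
    (hA.inter measurableSet_Ioo).inter
      (measurableSet_lt (f := fun _ : ℝ => ρ) (g := fun τ => √(1 - τ ^ 2)) (by fun_prop)
        (by fun_prop))
  have hpos : ∀ τ ∈ B, 0 < 1 - τ ^ 2 := by
    rintro τ ⟨⟨-, h1, h2⟩, -⟩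
    nlinarith
  have hsq : ∀ τ ∈ B, f τ ^ 2 + ρ ^ 2 = ρ ^ 2 / (1 - τ ^ 2) := by
    intro τ hτ
    have h := hpos τ hτ
    rw [hf]
    simp only [div_pow, Real.sq_sqrt h.le]
    field_simp
    ring
  have hinv : ∀ τ ∈ B, f τ / √(f τ ^ 2 + ρ ^ 2) = τ := by
    intro τ hτ
    have h := hpos τ hτ
    have h' := Real.sqrt_pos.2 h
    rw [hsq τ hτ, Real.sqrt_div (by positivity), Real.sqrt_sq hρ.le, hf]
    field_simp
  have himage : {s : ℝ | s ^ 2 + ρ ^ 2 < 1 ∧ s / √(s ^ 2 + ρ ^ 2) ∈ A} = f '' B := by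
    ext s
    constructor
    · rintro ⟨h1, h2⟩
      have h0 : 0 < s ^ 2 + ρ ^ 2 := by positivity
      have hs := Real.sqrt_pos.2 h0
      have hτ : 1 - (s / √(s ^ 2 + ρ ^ 2)) ^ 2 = (ρ / √(s ^ 2 + ρ ^ 2)) ^ 2 := by
        rw [div_pow, div_pow, Real.sq_sqrt h0.le]
        field_simp
        ring
      have hlt : (s / √(s ^ 2 + ρ ^ 2)) ^ 2 < 1 := by
        have : 0 < (ρ / √(s ^ 2 + ρ ^ 2)) ^ 2 := by positivity
        linarith
      refine ⟨s / √(s ^ 2 + ρ ^ 2), ⟨⟨h2, abs_lt.1 ((sq_lt_one_iff_abs_lt_one _).1 hlt)⟩, ?_⟩, ?_⟩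
      · rw [hτ, Real.sqrt_sq (by positivity), lt_div_iff₀ hs]
        have : √(s ^ 2 + ρ ^ 2) < 1 := by
          rw [Real.sqrt_lt' one_pos]; simpa using h1
        nlinarith
      · simp only [hf]
        rw [hτ, Real.sqrt_sq (by positivity)]
        field_simp
    · rintro ⟨τ, hτ, rfl⟩
      refine ⟨?_, ?_⟩
      · rw [hsq τ hτ, div_lt_one (hpos τ hτ)]
        have := hτ.2
        rwa [Real.lt_sqrt hρ.le] at this
      · rw [hinv τ hτ]
        exact hτ.1.1
  have hderiv : ∀ τ ∈ B, HasDerivWithinAt f (ρ / ((1 - τ ^ 2) * √(1 - τ ^ 2))) B τ := by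
    intro τ hτ
    have h := hpos τ hτ
    have h' := Real.sqrt_pos.2 h
    have h1 : HasDerivAt (fun τ : ℝ => 1 - τ ^ 2) (-(2 * τ)) τ := by
      simpa using ((hasDerivAt_pow 2 τ).const_sub 1)
    have h2 := h1.sqrt h.ne'
    have h3 := (((hasDerivAt_id τ).const_mul ρ).div h2 h'.ne').hasDerivWithinAt (s := B)
    refine h3.congr_deriv ?_
    have h4 : √(1 - τ ^ 2) ^ 2 = 1 - τ ^ 2 := Real.sq_sqrt h.le
    simp only [id]
    rw [h4]
    field_simp
    rw [h4]
    ring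
  have hinj : InjOn f B := fun a ha b hb hab => by
    rw [← hinv a ha, ← hinv b hb, hab]
  have key := lintegral_image_eq_lintegral_abs_deriv_mul hBm hderiv hinj 1
  rw [himage]
  simp only [Pi.one_apply, lintegral_one, Measure.restrict_apply_univ, mul_one] at key
  rw [key]
  have hBi : B = {τ : ℝ | ρ < √(1 - τ ^ 2)} ∩ (A ∩ Ioo (-1) 1) := by
    ext τ; simp only [hB, mem_ofPred_eq, mem_inter_iff]; tauto
  rw [hBi, ← Measure.restrict_restrict (measurableSet_lt (by fun_prop) (by fun_prop)),
    ← lintegral_indicator (measurableSet_lt (by fun_prop) (by fun_prop))]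
  refine setLIntegral_congr_fun (hA.inter measurableSet_Ioo) ?_
  rintro τ ⟨-, h1, h2⟩
  have h : 0 ≤ 1 - τ ^ 2 := by nlinarith
  have h3 : 0 ≤ ρ / ((1 - τ ^ 2) * √(1 - τ ^ 2)) := by positivity
  by_cases hτ : ρ < √(1 - τ ^ 2)
  · simp [indicator, hτ, abs_of_nonneg h3]
  · simp [indicator, hτ]

theorem surfaceMeasure_univ (m : ℕ) :
    surfaceMeasure m univ = ENNReal.ofReal (sphereArea m) := by
  have : IsFiniteMeasure (surfaceMeasure m) := by unfold surfaceMeasure; infer_instance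
  rw [sphereArea, ofReal_measureReal]

/-- The integral of the norm over a centred ball of `ℝ^m`. -/
theorem lintegral_norm_ball {m : ℕ} (hm : 1 ≤ m) {q : ℝ} (hq : 0 ≤ q) :
    ∫⁻ v : EuclideanSpace ℝ (Fin m), ENNReal.ofReal ‖v‖ * (Iio q).indicator 1 ‖v‖ =
      ENNReal.ofReal (sphereArea m) * ENNReal.ofReal (q ^ (m + 1) / (m + 1)) := by
  have : Nontrivial (EuclideanSpace ℝ (Fin m)) := by
    have : Nonempty (Fin m) := ⟨⟨0, hm⟩⟩
    infer_instance
  have hmeas : Measurable ((Iio q).indicator (1 : ℝ → ℝ≥0∞)) :=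
    measurable_one.indicator measurableSet_Iio
  rw [lintegral_fun_norm_addHaar (f := fun r => ENNReal.ofReal r * (Iio q).indicator 1 r) _
    (by fun_prop)]
  rw [← surfaceMeasure_univ]
  congr 1
  have h1 : ∀ r ∈ Ioi (0 : ℝ), ENNReal.ofReal (r ^ (finrank ℝ (EuclideanSpace ℝ (Fin m)) - 1)) *
      (ENNReal.ofReal r * (Iio q).indicator 1 r) =
      (Iio q).indicator (fun r => ENNReal.ofReal (r ^ m)) r := by
    intro r hr
    have hr : 0 < r := hr
    by_cases h : r < q
    · simp only [finrank_euclideanSpace, Fintype.card_fin, mem_Iio, h, indicator_of_mem,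
        Pi.one_apply, mul_one]
      rw [← ENNReal.ofReal_mul (by positivity), ← pow_succ, Nat.sub_add_cancel hm]
    · simp [h]
  rw [setLIntegral_congr_fun measurableSet_Ioi h1, lintegral_indicator measurableSet_Iio,
    Measure.restrict_restrict measurableSet_Iio, Iio_inter_Ioi,
    Measure.restrict_congr_set Ioo_ae_eq_Ioc, ← ofReal_integral_eq_lintegral_ofReal,
    ← intervalIntegral.integral_of_le hq]
  · simp
  · exact (intervalIntegral.intervalIntegrable_pow _).1
  · filter_upwards [ae_restrict_mem measurableSet_Ioc] with y hy
    exact pow_nonneg hy.1.le _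

/-- The distribution of the height of a point of the sphere above a hyperplane through the
centre. -/
theorem surfaceMeasure_inner_mem {m : ℕ} (hm : 1 ≤ m) {u : EuclideanSpace ℝ (Fin (m + 1))}
    (hu : ‖u‖ = 1) {A : Set ℝ} (hA : MeasurableSet A) :
    surfaceMeasure (m + 1) {y | ⟪(y : EuclideanSpace ℝ (Fin (m + 1))), u⟫ ∈ A} =
      ENNReal.ofReal (sphereArea m) *
        ∫⁻ s in A ∩ Ioo (-1) 1, ENNReal.ofReal ((1 - s ^ 2) ^ (((m : ℝ) - 2) / 2)) := by
  obtain ⟨Φ, hΦ, hΦ'⟩ := exists_measurePreserving_height hu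
  have hmeas : MeasurableSet {y : sphere (0 : EuclideanSpace ℝ (Fin (m + 1))) 1 |
      ⟪(y : EuclideanSpace ℝ (Fin (m + 1))), u⟫ ∈ A} :=
    measurableSet_preimage (f := fun y : sphere (0 : EuclideanSpace ℝ (Fin (m + 1))) 1 =>
      ⟪(y : EuclideanSpace ℝ (Fin (m + 1))), u⟫) (by fun_prop) hA
  set T : Set (ℝ × EuclideanSpace ℝ (Fin m)) :=
    {p | p.1 ^ 2 + ‖p.2‖ ^ 2 < 1 ∧ p.1 / √(p.1 ^ 2 + ‖p.2‖ ^ 2) ∈ A} with hT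
  have hTm : MeasurableSet T :=
    (measurableSet_lt (f := fun p : ℝ × EuclideanSpace ℝ (Fin m) => p.1 ^ 2 + ‖p.2‖ ^ 2)
      (g := fun _ => 1) (by fun_prop) (by fun_prop)).inter
      (measurableSet_preimage (f := fun p : ℝ × EuclideanSpace ℝ (Fin m) =>
        p.1 / √(p.1 ^ 2 + ‖p.2‖ ^ 2)) (by fun_prop) hA)
  have hcone : Ioo (0 : ℝ) 1 • ((↑) '' {y : sphere (0 : EuclideanSpace ℝ (Fin (m + 1))) 1 |
      ⟪(y : EuclideanSpace ℝ (Fin (m + 1))), u⟫ ∈ A}) = Φ ⁻¹' T \ {0} := by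
    ext x
    have hx := hΦ' x
    simp only [Set.mem_smul, mem_image, Set.mem_sdiff, mem_preimage, hT, mem_ofPred_eq, ← hx.2,
      Real.sqrt_sq (norm_nonneg _), mem_singleton_iff]
    rw [hx.1]
    constructor
    · rintro ⟨r, hr, z, ⟨y, hy, rfl⟩, rfl⟩
      have hy1 : ‖(y : EuclideanSpace ℝ (Fin (m + 1)))‖ = 1 := by simp
      have hn : ‖r • (y : EuclideanSpace ℝ (Fin (m + 1)))‖ = r := by
        rw [norm_smul, hy1, mul_one, Real.norm_of_nonneg hr.1.le]
      refine ⟨⟨?_, ?_⟩, ?_⟩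
      · rw [hn]; nlinarith [hr.1, hr.2]
      · rw [hn, real_inner_smul_left, mul_div_cancel_left₀ _ hr.1.ne']; exact hy
      · exact norm_ne_zero_iff.1 (by rw [hn]; exact hr.1.ne')
    · rintro ⟨⟨h1, h2⟩, h3⟩
      have hn : 0 < ‖x‖ := norm_pos_iff.2 h3
      refine ⟨‖x‖, ⟨hn, ?_⟩, ‖x‖⁻¹ • x, ⟨⟨‖x‖⁻¹ • x, ?_⟩, ?_, rfl⟩, ?_⟩
      · exact (sq_lt_one_iff₀ hn.le).1 h1
      · simp [norm_smul, hn.ne']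
      · simp only [real_inner_smul_left]
        rwa [inv_mul_eq_div]
      · rw [smul_inv_smul₀ hn.ne']
  have : Nontrivial (EuclideanSpace ℝ (Fin m)) := by
    have : Nonempty (Fin m) := ⟨⟨0, hm⟩⟩
    infer_instance
  have hvol : volume T = ENNReal.ofReal (sphereArea m) * ENNReal.ofReal (1 / (m + 1)) *
      ∫⁻ s in A ∩ Ioo (-1) 1, ENNReal.ofReal ((1 - s ^ 2) ^ (((m : ℝ) - 2) / 2)) := by
    have hind : ∀ τ : ℝ, Measurable ((Iio √(1 - τ ^ 2)).indicator (1 : ℝ → ℝ≥0∞)) := fun τ =>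
      measurable_one.indicator measurableSet_Iio
    have hjoint : Measurable (Function.uncurry fun (v : EuclideanSpace ℝ (Fin m)) (τ : ℝ) =>
        ENNReal.ofReal (‖v‖ / ((1 - τ ^ 2) * √(1 - τ ^ 2))) *
          (Iio √(1 - τ ^ 2)).indicator 1 ‖v‖) := by
      refine Measurable.mul (by fun_prop) ?_
      exact (measurable_one (α := ℝ≥0∞)
        (β := EuclideanSpace ℝ (Fin m) × ℝ)).indicator (s := {p | ‖p.1‖ < √(1 - p.2 ^ 2)})
        (measurableSet_lt (by fun_prop) (by fun_prop))
    calc volume T = ∫⁻ v : EuclideanSpace ℝ (Fin m), volume ((fun s : ℝ => (s, v)) ⁻¹' T) := by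
          rw [Measure.volume_eq_prod, Measure.prod_apply_symm hTm]
      _ = ∫⁻ v : EuclideanSpace ℝ (Fin m), ∫⁻ τ in A ∩ Ioo (-1) 1,
            ENNReal.ofReal (‖v‖ / ((1 - τ ^ 2) * √(1 - τ ^ 2))) *
              (Iio √(1 - τ ^ 2)).indicator 1 ‖v‖ := by
          refine lintegral_congr_ae ?_
          filter_upwards [compl_mem_ae_iff.2 (measure_singleton (0 : EuclideanSpace ℝ (Fin m)))]
            with v hv
          exact volume_line_eq_lintegral_cos (norm_pos_iff.2 hv) hA
      _ = ∫⁻ τ in A ∩ Ioo (-1) 1, ∫⁻ v : EuclideanSpace ℝ (Fin m),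
            ENNReal.ofReal (‖v‖ / ((1 - τ ^ 2) * √(1 - τ ^ 2))) *
              (Iio √(1 - τ ^ 2)).indicator 1 ‖v‖ :=
          lintegral_lintegral_swap hjoint.aemeasurable
      _ = ∫⁻ τ in A ∩ Ioo (-1) 1, ENNReal.ofReal (sphereArea m) * ENNReal.ofReal (1 / (m + 1)) *
            ENNReal.ofReal ((1 - τ ^ 2) ^ (((m : ℝ) - 2) / 2)) := by
          refine setLIntegral_congr_fun (hA.inter measurableSet_Ioo) ?_
          rintro τ ⟨-, h1, h2⟩
          have h : 0 < 1 - τ ^ 2 := by nlinarith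
          have hs := Real.sqrt_pos.2 h
          have e : ∀ v : EuclideanSpace ℝ (Fin m),
              ENNReal.ofReal (‖v‖ / ((1 - τ ^ 2) * √(1 - τ ^ 2))) *
                (Iio √(1 - τ ^ 2)).indicator 1 ‖v‖ =
              ENNReal.ofReal (1 / ((1 - τ ^ 2) * √(1 - τ ^ 2))) * (ENNReal.ofReal ‖v‖ *
                (Iio √(1 - τ ^ 2)).indicator 1 ‖v‖) := by
            intro v
            rw [← mul_assoc, ← ENNReal.ofReal_mul (by positivity)]
            congr 2
            field_simp
          have hi := hind τ
          simp only [e]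
          rw [lintegral_const_mul _ (by fun_prop), lintegral_norm_ball hm hs.le,
            mul_left_comm, mul_assoc, ← ENNReal.ofReal_mul (by positivity),
            ← ENNReal.ofReal_mul (p := 1 / ((m : ℝ) + 1)) (by positivity)]
          congr 2
          have e1 : √(1 - τ ^ 2) ^ (m + 1) = (1 - τ ^ 2) ^ (((m : ℝ) - 2) / 2) *
              ((1 - τ ^ 2) * √(1 - τ ^ 2)) := by
            rw [Real.sqrt_eq_rpow, ← Real.rpow_natCast, ← Real.rpow_mul h.le, ← mul_assoc,
              ← Real.rpow_add_one h.ne', ← Real.rpow_add h]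
            congr 1
            push_cast
            ring
          rw [e1]
          field_simp
      _ = _ := by
          rw [lintegral_const_mul _ (by fun_prop)]
  rw [surfaceMeasure, Measure.toSphere_apply' _ hmeas, hcone,
    measure_sdiff_null (measure_singleton _), hΦ.measure_preimage hTm.nullMeasurableSet, hvol,
    mul_comm (ENNReal.ofReal (sphereArea m)), mul_assoc, ← mul_assoc]
  have : (finrank ℝ (EuclideanSpace ℝ (Fin (m + 1))) : ℝ≥0∞) *
      ENNReal.ofReal (1 / (m + 1)) = 1 := by
    rw [finrank_euclideanSpace, Fintype.card_fin, ← ENNReal.ofReal_natCast,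
      ← ENNReal.ofReal_mul (by positivity)]
    rw [ENNReal.ofReal_eq_one]
    push_cast
    field_simp
  rw [this, one_mul]

/-! ### Volumes of simplices and determinants -/

/-- The simplex `{c ≥ 0, ∑ c ≤ s}` in `ℝ^n`, spanned by the origin and the multiples by `s` of the
standard basis vectors. -/
def cornerSimplex (n : ℕ) (s : ℝ) : Set (Fin n → ℝ) := {c | (∀ i, 0 ≤ c i) ∧ ∑ i, c i ≤ s}

theorem convex_cornerSimplex (n : ℕ) (s : ℝ) : Convex ℝ (cornerSimplex n s) := by
  rintro x ⟨hx1, hx2⟩ y ⟨hy1, hy2⟩ a b ha hb hab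
  refine ⟨fun i => ?_, ?_⟩
  · have := hx1 i
    have := hy1 i
    simp only [Pi.add_apply, Pi.smul_apply, smul_eq_mul]
    positivity
  · simp only [Pi.add_apply, Pi.smul_apply, smul_eq_mul, Finset.sum_add_distrib, ← Finset.mul_sum]
    calc a * ∑ i, x i + b * ∑ i, y i ≤ a * s + b * s := by gcongr
      _ = s := by rw [← add_mul, hab, one_mul]

theorem volume_cornerSimplex (n : ℕ) {s : ℝ} (hs : 0 ≤ s) :
    volume (cornerSimplex n s) = ENNReal.ofReal (s ^ n / n !) := by
  induction n generalizing s with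
  | zero =>
    have : cornerSimplex 0 s = univ := by ext; simp [cornerSimplex, hs]
    rw [this, volume_pi, Measure.pi_univ]
    simp
  | succ n ih =>
    have hpre : cornerSimplex (n + 1) s =
        MeasurableEquiv.piFinSuccAbove (fun _ : Fin (n + 1) => ℝ) 0 ⁻¹'
          {p | 0 ≤ p.1 ∧ p.2 ∈ cornerSimplex n (s - p.1)} := by
      ext c
      simp only [cornerSimplex, mem_ofPred_eq, mem_preimage, Fin.forall_fin_succ, Fin.sum_univ_succ]
      rw [and_assoc]
      refine and_congr Iff.rfl (and_congr Iff.rfl ?_)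
      exact le_sub_iff_add_le'.symm
    have hmeas : MeasurableSet
        {p : ℝ × (Fin n → ℝ) | 0 ≤ p.1 ∧ p.2 ∈ cornerSimplex n (s - p.1)} := by
      have : {p : ℝ × (Fin n → ℝ) | 0 ≤ p.1 ∧ p.2 ∈ cornerSimplex n (s - p.1)} =
          {p | 0 ≤ p.1} ∩ ((⋂ i, {p | 0 ≤ p.2 i}) ∩ {p | ∑ i, p.2 i ≤ s - p.1}) := by
        ext; simp [cornerSimplex]
      rw [this]
      exact (measurableSet_le (by fun_prop) (by fun_prop)).inter
        ((MeasurableSet.iInter fun i => measurableSet_le (by fun_prop) (by fun_prop)).inter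
          (measurableSet_le (by fun_prop) (by fun_prop)))
    rw [hpre, (volume_preserving_piFinSuccAbove (fun _ : Fin (n + 1) => ℝ) 0).measure_preimage
      hmeas.nullMeasurableSet, Measure.volume_eq_prod, Measure.prod_apply hmeas]
    have hslice : ∀ a : ℝ, volume (Prod.mk a ⁻¹'
        {p : ℝ × (Fin n → ℝ) | 0 ≤ p.1 ∧ p.2 ∈ cornerSimplex n (s - p.1)}) =
        (Icc 0 s).indicator (fun a => ENNReal.ofReal ((s - a) ^ n / n !)) a := by
      intro a
      by_cases ha : a ∈ Icc 0 s
      · rw [indicator_of_mem ha, ← ih (sub_nonneg.2 ha.2)]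
        congr 1
        ext c
        simp [ha.1]
      · rw [indicator_of_notMem ha]
        convert measure_empty (μ := (volume : Measure (Fin n → ℝ)))
        rw [eq_empty_iff_forall_notMem]
        rintro c ⟨h1, h2, h3⟩
        simp only at h1 h2 h3
        exact ha ⟨h1, by linarith [Finset.sum_nonneg fun i (_ : i ∈ Finset.univ) => h2 i]⟩
    simp only [hslice]
    rw [lintegral_indicator measurableSet_Icc, Measure.restrict_congr_set Ioc_ae_eq_Icc.symm,
      ← ofReal_integral_eq_lintegral_ofReal, ← intervalIntegral.integral_of_le hs]
    · congr 1
      rw [intervalIntegral.integral_div,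
        intervalIntegral.integral_comp_sub_left (fun x : ℝ => x ^ n) s, sub_self, sub_zero,
        integral_pow, Nat.factorial_succ]
      push_cast
      field_simp
      simp
    · exact (Continuous.intervalIntegrable (by fun_prop) 0 s).1
    · filter_upwards [ae_restrict_mem measurableSet_Ioc] with y hy
      have := sub_nonneg.2 hy.2
      positivity

/-- The square matrix whose rows are the given vectors. -/
def rowMatrix {n : ℕ} (v : Fin n → EuclideanSpace ℝ (Fin n)) : Matrix (Fin n) (Fin n) ℝ :=
  Matrix.of fun i j => v i j

@[simp]
theorem rowMatrix_apply {n : ℕ} (v : Fin n → EuclideanSpace ℝ (Fin n)) (i j : Fin n) :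
    rowMatrix v i j = v i j := rfl

theorem rowMatrix_mulVec {n : ℕ} (v : Fin n → EuclideanSpace ℝ (Fin n))
    (w : EuclideanSpace ℝ (Fin n)) (i : Fin n) : (rowMatrix v).mulVec w.ofLp i = ⟪v i, w⟫ := by
  simp [Matrix.mulVec, dotProduct, PiLp.inner_apply, mul_comm]

/-- A simplex is the affine image of the corner simplex. -/
theorem convexHull_range_eq_image_cornerSimplex {n : ℕ} {E : Type*} [AddCommGroup E] [Module ℝ E]
    (p : Fin (n + 1) → E) :
    convexHull ℝ (range p) =
      (fun c : Fin n → ℝ => p 0 + ∑ i, c i • (p i.succ - p 0)) '' cornerSimplex n 1 := by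
  apply subset_antisymm
  · refine convexHull_min ?_ ?_
    · rintro _ ⟨i, rfl⟩
      refine Fin.cases ?_ (fun i => ?_) i
      · exact ⟨0, ⟨by simp, by simp⟩, by simp⟩
      · refine ⟨Pi.single i 1, ⟨fun j => ?_, ?_⟩, ?_⟩
        · rw [Pi.single_apply]; split_ifs <;> norm_num
        · simp
        · simp [Pi.single_apply, ite_smul]
    · rintro _ ⟨c, hc, rfl⟩ _ ⟨d, hd, rfl⟩ a b ha hb hab
      refine ⟨a • c + b • d, convex_cornerSimplex n 1 hc hd ha hb hab, ?_⟩
      simp only [Pi.add_apply, Pi.smul_apply, smul_add, Finset.smul_sum, smul_eq_mul, add_smul,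
        Finset.sum_add_distrib, mul_smul]
      have : p 0 = a • p 0 + b • p 0 := by rw [← add_smul, hab, one_smul]
      nth_rw 1 [this]
      abel
  · rintro _ ⟨c, ⟨hc, hc1⟩, rfl⟩
    have h := (convex_convexHull ℝ (range p)).sum_mem (t := Finset.univ)
      (w := Fin.cons (1 - ∑ i, c i) c) (z := p)
      (fun i _ => Fin.cases (by simpa using hc1) (fun i => by simpa using hc i) i)
      (by simp [Fin.sum_univ_succ]) (fun i _ => subset_convexHull ℝ _ (mem_range_self i))
    convert h using 1
    simp only [Fin.sum_univ_succ, Fin.cons_zero, Fin.cons_succ, smul_sub, Finset.sum_sub_distrib,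
      sub_smul, one_smul, Finset.sum_smul]
    abel

theorem simplexVol_eq {n : ℕ} (x : Fin (n + 1) → sphere (0 : EuclideanSpace ℝ (Fin n)) 1) :
    simplexVol x =
      |(rowMatrix fun i => (x i.succ : EuclideanSpace ℝ (Fin n)) - x 0).det| / n ! := by
  set A := rowMatrix fun i => (x i.succ : EuclideanSpace ℝ (Fin n)) - x 0 with hA
  have himage : convexHull ℝ (range fun i => (x i : EuclideanSpace ℝ (Fin n))) =
      (MeasurableEquiv.toLp 2 (Fin n → ℝ)).symm ⁻¹'
        ((fun c => (x 0 : EuclideanSpace ℝ (Fin n)).ofLp + c) ''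
          (Matrix.toLin' A.transpose '' cornerSimplex n 1)) := by
    rw [convexHull_range_eq_image_cornerSimplex, image_image]
    ext y
    simp only [mem_image, mem_preimage]
    refine exists_congr fun c => and_congr Iff.rfl ?_
    have : ((x 0 : EuclideanSpace ℝ (Fin n)).ofLp + Matrix.toLin' A.transpose c) =
        ((x 0 : EuclideanSpace ℝ (Fin n)) +
          ∑ i, c i • ((x i.succ : EuclideanSpace ℝ (Fin n)) - x 0)).ofLp := by
      ext j
      simp [hA, Matrix.mulVec, dotProduct, mul_comm]
    rw [this]
    exact (WithLp.ofLp_injective 2).eq_iff.symm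
  have hpres : MeasurePreserving (MeasurableEquiv.toLp 2 (Fin n → ℝ)).symm volume volume :=
    PiLp.volume_preserving_ofLp (Fin n)
  rw [simplexVol, Measure.real, himage, hpres.measure_preimage_equiv, image_add_left,
    measure_preimage_add, Measure.addHaar_image_linearMap, LinearMap.det_toLin',
    Matrix.det_transpose, volume_cornerSimplex n zero_le_one, ← ENNReal.ofReal_mul (abs_nonneg _),
    ENNReal.toReal_ofReal (by positivity), one_pow, mul_one_div]

/-- Hadamard's inequality. -/
theorem abs_det_rowMatrix_le {n : ℕ} (v : Fin n → EuclideanSpace ℝ (Fin n)) :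
    |(rowMatrix v).det| ≤ ∏ i, ‖v i‖ := by
  have : Fact (finrank ℝ (EuclideanSpace ℝ (Fin n)) = n) := ⟨by simp⟩
  let b := EuclideanSpace.basisFun (Fin n) ℝ
  have h := (b.toBasis.orientation).abs_volumeForm_apply_le v
  rw [Orientation.volumeForm_robust' _ b, Basis.det_apply] at h
  convert h using 2
  rw [← Matrix.det_transpose]
  rfl

/-- The matrix determinant lemma: if the hyperplane `⟪·, w⟫ = 1` passes through all the points
`v i`, then the volume spanned from a further point `y` is proportional to the distance of `y` from
this hyperplane. -/
theorem det_rowMatrix_sub {n : ℕ} {v : Fin n → EuclideanSpace ℝ (Fin n)}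
    (hv : (rowMatrix v).det ≠ 0) {w : EuclideanSpace ℝ (Fin n)} (hw : ∀ i, ⟪v i, w⟫ = 1)
    (y : EuclideanSpace ℝ (Fin n)) :
    (rowMatrix fun i => v i - y).det = (rowMatrix v).det * (1 - ⟪y, w⟫) := by
  have hunit : IsUnit (rowMatrix v).det := hv.isUnit
  have h1 : (rowMatrix v).mulVec w.ofLp = 1 := by
    ext i; rw [rowMatrix_mulVec, hw]; rfl
  have h2 : (rowMatrix v)⁻¹.mulVec 1 = w.ofLp := by
    rw [← h1, Matrix.mulVec_mulVec, Matrix.nonsing_inv_mul _ hunit, Matrix.one_mulVec]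
  let e : Matrix (Fin n) Unit ℝ := Matrix.replicateCol Unit 1
  let f : Matrix Unit (Fin n) ℝ := Matrix.replicateRow Unit (-y.ofLp)
  have h3 : (rowMatrix fun i => v i - y) = rowMatrix v + e * f := by
    ext i j
    simp [e, f, Matrix.mul_apply, sub_eq_add_neg]
  rw [h3, Matrix.det_add_replicateCol_mul_replicateRow hunit, Matrix.mul_assoc,
    ← Matrix.replicateCol_mulVec, h2,
    Matrix.det_unique (n := Unit)]
  congr 1
  simp [Matrix.mul_apply, PiLp.inner_apply, sub_eq_add_neg, mul_comm]

/-! ### General position and the hyperplane through `n` random points -/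

theorem sphereArea_eq (m : ℕ) : sphereArea m = m * ballVol m := by
  rw [sphereArea, surfaceMeasure, Measure.toSphere_real_apply_univ, ballVol]
  simp

theorem ballVol_pos (m : ℕ) : 0 < ballVol m :=
  ENNReal.toReal_pos (isOpen_ball.measure_ne_zero _ (by simp)) measure_ball_lt_top.ne

theorem sphereArea_pos {m : ℕ} (hm : 1 ≤ m) : 0 < sphereArea m := by
  rw [sphereArea_eq]
  have := ballVol_pos m
  positivity

theorem sphereArea_nonneg (m : ℕ) : 0 ≤ sphereArea m := measureReal_nonneg

theorem isProbabilityMeasure_uniformSphere {n : ℕ} (hn : 1 ≤ n) :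
    IsProbabilityMeasure (uniformSphere n) := by
  have h := ENNReal.ofReal_pos.2 (sphereArea_pos hn)
  refine ⟨?_⟩
  rw [uniformSphere, Measure.smul_apply, smul_eq_mul, surfaceMeasure_univ,
    ENNReal.inv_mul_cancel h.ne' ENNReal.ofReal_ne_top]

theorem uniformSphere_inner_mem {m : ℕ} (hm : 1 ≤ m) {u : EuclideanSpace ℝ (Fin (m + 1))}
    (hu : ‖u‖ = 1) {A : Set ℝ} (hA : MeasurableSet A) :
    uniformSphere (m + 1) {y | ⟪(y : EuclideanSpace ℝ (Fin (m + 1))), u⟫ ∈ A} =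
      ENNReal.ofReal (sphereArea m / sphereArea (m + 1)) *
        ∫⁻ s in A ∩ Ioo (-1) 1, ENNReal.ofReal ((1 - s ^ 2) ^ (((m : ℝ) - 2) / 2)) := by
  rw [uniformSphere, Measure.smul_apply, smul_eq_mul, surfaceMeasure_inner_mem hm hu hA,
    ← mul_assoc, surfaceMeasure_univ, ← ENNReal.ofReal_inv_of_pos (sphereArea_pos (by omega)),
    ← ENNReal.ofReal_mul (inv_nonneg.2 (sphereArea_nonneg _)), inv_mul_eq_div]

theorem uniformSphere_hyperplane {m : ℕ} (hm : 1 ≤ m) {u : EuclideanSpace ℝ (Fin (m + 1))}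
    (hu : u ≠ 0) :
    uniformSphere (m + 1) {y | ⟪(y : EuclideanSpace ℝ (Fin (m + 1))), u⟫ = 0} = 0 := by
  have hn : ‖u‖ ≠ 0 := norm_ne_zero_iff.2 hu
  have h := uniformSphere_inner_mem hm (u := ‖u‖⁻¹ • u) (by simp [norm_smul, hn])
    (measurableSet_singleton 0)
  have h0 : volume ({0} ∩ Ioo (-1 : ℝ) 1) = 0 :=
    measure_mono_null inter_subset_left (measure_singleton 0)
  rw [setLIntegral_measure_zero _ _ h0, mul_zero] at h
  convert h using 3 with y
  simp [real_inner_smul_right, hn]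

theorem uniformSphere_submodule {m : ℕ} (hm : 1 ≤ m)
    {V : Submodule ℝ (EuclideanSpace ℝ (Fin (m + 1)))} (hV : V ≠ ⊤) :
    uniformSphere (m + 1) {y | (y : EuclideanSpace ℝ (Fin (m + 1))) ∈ V} = 0 := by
  obtain ⟨u, hu, hu0⟩ := Submodule.exists_mem_ne_zero_of_ne_bot
    (mt Submodule.orthogonal_eq_bot_iff.1 hV)
  refine measure_mono_null (fun y hy => ?_) (uniformSphere_hyperplane hm hu0)
  exact hu _ hy

theorem measurable_finCons_prod (α : Type*) [MeasurableSpace α] (k : ℕ) :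
    Measurable fun p : α × (Fin k → α) => (Fin.cons p.1 p.2 : Fin (k + 1) → α) :=
  measurable_pi_lambda _ fun i => Fin.cases (by simpa using measurable_fst)
    (fun i => by simp only [Fin.cons_succ]; fun_prop) i

/-- Fubini's theorem for a power of a probability measure, the first coordinate being integrated
first. -/
theorem pi_apply_eq_lintegral_cons {α : Type*} [MeasurableSpace α] (σ : Measure α)
    [IsProbabilityMeasure σ] {k : ℕ} {s : Set (Fin (k + 1) → α)} (hs : MeasurableSet s) :
    Measure.pi (fun _ : Fin (k + 1) => σ) s =
      ∫⁻ v, σ {y | (Fin.cons y v : Fin (k + 1) → α) ∈ s} ∂Measure.pi (fun _ : Fin k => σ) := by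
  have hpres := measurePreserving_piFinSuccAbove (fun _ : Fin (k + 1) => σ) 0
  rw [← hpres.symm.measure_preimage_equiv,
    Measure.prod_apply_symm ((MeasurableEquiv.measurable _) hs)]
  simp only [MeasurableEquiv.piFinSuccAbove_symm_apply, Fin.insertNthEquiv_zero]
  rfl

theorem continuous_coe_pi_sphere (n k : ℕ) :
    Continuous fun (x : Fin k → sphere (0 : EuclideanSpace ℝ (Fin n)) 1) (i : Fin k) =>
      (x i : EuclideanSpace ℝ (Fin n)) := by
  fun_prop

theorem ae_linearIndependent {m : ℕ} (hm : 1 ≤ m) {k : ℕ} (hk : k ≤ m + 1) :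
    ∀ᵐ x ∂Measure.pi (fun _ : Fin k => uniformSphere (m + 1)),
      LinearIndependent ℝ (fun i => (x i : EuclideanSpace ℝ (Fin (m + 1)))) := by
  have := isProbabilityMeasure_uniformSphere (n := m + 1) (by omega)
  induction k with
  | zero => exact .of_forall fun x => linearIndependent_empty_type
  | succ k ih =>
    have hmeas : MeasurableSet {x : Fin (k + 1) → sphere (0 : EuclideanSpace ℝ (Fin (m + 1))) 1 |
        LinearIndependent ℝ (fun i => (x i : EuclideanSpace ℝ (Fin (m + 1))))} :=
      (isOpen_setOfPred_linearIndependent.preimage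
        (continuous_coe_pi_sphere (m + 1) (k + 1))).measurableSet
    rw [ae_iff]
    refine (pi_apply_eq_lintegral_cons _ hmeas.compl).trans ?_
    rw [lintegral_eq_zero_iff' ?_]
    · filter_upwards [ih (by omega)] with v hv
      have hspan : Submodule.span ℝ
          (range fun i => (v i : EuclideanSpace ℝ (Fin (m + 1)))) ≠ ⊤ := by
        intro h
        have h1 := finrank_span_eq_card hv
        rw [h, finrank_top, finrank_euclideanSpace, Fintype.card_fin, Fintype.card_fin] at h1
        omega
      refine measure_mono_null (fun y hy => ?_) (uniformSphere_submodule hm hspan)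
      by_contra hy'
      refine hy ?_
      have h := linearIndependent_finCons.2 ⟨hv, hy'⟩
      have hcons : (fun i => (((Fin.cons y v : Fin (k + 1) → sphere _ 1) i :) :
          EuclideanSpace ℝ (Fin (m + 1)))) = Fin.cons ↑y fun i => ↑(v i) := by
        funext i
        refine Fin.cases ?_ (fun i => ?_) i <;> simp
      rw [mem_ofPred_eq, hcons]
      exact h
    · have : MeasurableSet {p : sphere (0 : EuclideanSpace ℝ (Fin (m + 1))) 1 ×
          (Fin k → sphere (0 : EuclideanSpace ℝ (Fin (m + 1))) 1) |
          (Fin.cons p.1 p.2 : Fin (k + 1) → _) ∈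
            {x : Fin (k + 1) → sphere (0 : EuclideanSpace ℝ (Fin (m + 1))) 1 |
              LinearIndependent ℝ (fun i => (x i : EuclideanSpace ℝ (Fin (m + 1))))}ᶜ} :=
        measurableSet_preimage (measurable_finCons_prod _ k) hmeas.compl
      exact (measurable_measure_prodMk_right this).aemeasurable

theorem det_rowMatrix_ne_zero_iff {n : ℕ} {v : Fin n → EuclideanSpace ℝ (Fin n)} :
    (rowMatrix v).det ≠ 0 ↔ LinearIndependent ℝ v := by
  rw [← isUnit_iff_ne_zero, ← Matrix.isUnit_iff_isUnit_det,
    ← Matrix.linearIndependent_rows_iff_isUnit,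
    ← LinearMap.linearIndependent_iff (WithLp.linearEquiv 2 ℝ (Fin n → ℝ)).toLinearMap
      (LinearEquiv.ker _)]
  rfl

theorem ae_det_rowMatrix_ne_zero {m : ℕ} (hm : 1 ≤ m) :
    ∀ᵐ x ∂Measure.pi (fun _ : Fin (m + 1) => uniformSphere (m + 1)),
      (rowMatrix fun i => (x i : EuclideanSpace ℝ (Fin (m + 1)))).det ≠ 0 := by
  filter_upwards [ae_linearIndependent hm le_rfl] with x hx
  exact det_rowMatrix_ne_zero_iff.2 hx

/-- The normal vector `w` of the hyperplane through the points `v i`, normalized such that this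
hyperplane is `⟪·, w⟫ = 1`; its distance from the origin is `1 / ‖w‖`. Meaningful for linearly
independent `v` only. -/
noncomputable def hyperplaneNormal {n : ℕ} (v : Fin n → EuclideanSpace ℝ (Fin n)) :
    EuclideanSpace ℝ (Fin n) :=
  WithLp.toLp 2 ((rowMatrix v)⁻¹.mulVec 1)

theorem inner_hyperplaneNormal {n : ℕ} {v : Fin n → EuclideanSpace ℝ (Fin n)}
    (hv : (rowMatrix v).det ≠ 0) (i : Fin n) : ⟪v i, hyperplaneNormal v⟫ = 1 := by
  rw [← rowMatrix_mulVec, hyperplaneNormal, Matrix.mulVec_mulVec,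
    Matrix.mul_nonsing_inv _ hv.isUnit, Matrix.one_mulVec, Pi.one_apply]

theorem one_le_norm_hyperplaneNormal {m : ℕ}
    {x : Fin (m + 1) → sphere (0 : EuclideanSpace ℝ (Fin (m + 1))) 1}
    (hx : (rowMatrix fun i => (x i : EuclideanSpace ℝ (Fin (m + 1)))).det ≠ 0) :
    1 ≤ ‖hyperplaneNormal fun i => (x i : EuclideanSpace ℝ (Fin (m + 1)))‖ := by
  have h := real_inner_le_norm (x 0 : EuclideanSpace ℝ (Fin (m + 1)))
    (hyperplaneNormal fun i => (x i : EuclideanSpace ℝ (Fin (m + 1))))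
  rw [inner_hyperplaneNormal hx 0] at h
  simpa using h

theorem measurable_simplexVol (n : ℕ) : Measurable (simplexVol (n := n)) := by
  have : simplexVol (n := n) = fun x =>
      |(rowMatrix fun i => (x i.succ : EuclideanSpace ℝ (Fin n)) -
        (x 0 : EuclideanSpace ℝ (Fin n))).det| / n ! :=
    funext simplexVol_eq
  rw [this]
  refine Continuous.measurable ?_
  have : Continuous fun x : Fin (n + 1) → sphere (0 : EuclideanSpace ℝ (Fin n)) 1 =>
      (rowMatrix fun i => (x i.succ : EuclideanSpace ℝ (Fin n)) -
        (x 0 : EuclideanSpace ℝ (Fin n))).det :=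
    Continuous.matrix_det (continuous_matrix fun i j => by simp only [rowMatrix_apply]; fun_prop)
  fun_prop

/-- Conditionally on the other vertices, the volume of the simplex is at most `t` if and only if the
first vertex lies in a slab around the hyperplane through the others. -/
theorem pi_simplexVol_le {m : ℕ} (hm : 1 ≤ m) (t : ℝ) :
    Measure.pi (fun _ : Fin (m + 1 + 1) => uniformSphere (m + 1)) {x | simplexVol x ≤ t} =
      ∫⁻ v, uniformSphere (m + 1)
        {y | |(rowMatrix fun i => (v i : EuclideanSpace ℝ (Fin (m + 1)))).det| *
          |1 - ⟪(y : EuclideanSpace ℝ (Fin (m + 1))),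
            hyperplaneNormal fun i => (v i : EuclideanSpace ℝ (Fin (m + 1)))⟫| ≤ (m + 1)! * t}
        ∂Measure.pi (fun _ : Fin (m + 1) => uniformSphere (m + 1)) := by
  have := isProbabilityMeasure_uniformSphere (n := m + 1) (by omega)
  rw [pi_apply_eq_lintegral_cons _ (measurableSet_le (measurable_simplexVol _) measurable_const)]
  refine lintegral_congr_ae ?_
  filter_upwards [ae_det_rowMatrix_ne_zero hm] with v hv
  congr 1
  ext y
  rw [mem_ofPred_eq, mem_ofPred_eq, simplexVol_eq, div_le_iff₀' (by positivity)]
  simp only [Fin.cons_succ, Fin.cons_zero]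
  rw [det_rowMatrix_sub hv (inner_hyperplaneNormal hv), abs_mul]

/-! ### Measures of slabs and the integral over all hyperplanes -/

/-- Euler's beta integral after the substitution `x = r⁻²`. -/
theorem lintegral_inv_sq_eq_beta {b : ℝ} (hb : 0 < b) :
    ∫⁻ r in Ioi (1 : ℝ), ENNReal.ofReal (r⁻¹ ^ 2 * (1 - r⁻¹ ^ 2) ^ (b - 1)) =
      ENNReal.ofReal (beta (1 / 2) b / 2) := by
  have hβ : 0 < beta (1 / 2) b := beta_pos (by norm_num) hb
  have h1 := lintegral_betaPDF_eq_one (α := 1 / 2) (β := b) (by norm_num) hb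
  rw [lintegral_betaPDF] at h1
  have himage : (fun r : ℝ => r⁻¹ ^ 2) '' Ioi 1 = Ioo 0 1 := by
    ext x
    constructor
    · rintro ⟨r, hr, rfl⟩
      have hr : 1 < r := hr
      have : r⁻¹ < 1 := inv_lt_one_of_one_lt₀ hr
      have h0 : 0 < r⁻¹ := by positivity
      exact ⟨by positivity, by simp only; nlinarith⟩
    · rintro ⟨h0, h1⟩
      refine ⟨(√x)⁻¹, ?_, ?_⟩
      · exact (one_lt_inv₀ (Real.sqrt_pos.2 h0)).2 (by rw [Real.sqrt_lt' one_pos]; simpa using h1)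
      · simp [Real.sq_sqrt h0.le]
  have hderiv : ∀ r ∈ Ioi (1 : ℝ),
      HasDerivWithinAt (fun r : ℝ => r⁻¹ ^ 2) (-(2 * r⁻¹ ^ 3)) (Ioi 1) r := by
    intro r hr
    have hr : 1 < r := hr
    have h0 : r ≠ 0 := by positivity
    refine (((hasDerivAt_inv h0).pow 2).congr_deriv ?_).hasDerivWithinAt
    field_simp
    simp [h0]
  have hinj : InjOn (fun r : ℝ => r⁻¹ ^ 2) (Ioi 1) := by
    intro r hr s hs h
    have hr : 1 < r := hr
    have hs : 1 < s := hs
    exact inv_injective ((pow_left_inj₀ (by positivity) (by positivity) two_ne_zero).1 h)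
  rw [← himage, lintegral_image_eq_lintegral_abs_deriv_mul measurableSet_Ioi hderiv hinj] at h1
  have hcongr : ∀ r ∈ Ioi (1 : ℝ), ENNReal.ofReal |-(2 * r⁻¹ ^ 3)| *
      ENNReal.ofReal (1 / beta (1 / 2) b * (r⁻¹ ^ 2) ^ ((1 / 2 : ℝ) - 1) *
        (1 - r⁻¹ ^ 2) ^ (b - 1)) = ENNReal.ofReal (2 / beta (1 / 2) b) *
      ENNReal.ofReal (r⁻¹ ^ 2 * (1 - r⁻¹ ^ 2) ^ (b - 1)) := by
    intro r hr
    have hr : 1 < r := hr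
    have h0 : 0 < r⁻¹ := by positivity
    rw [← ENNReal.ofReal_mul (abs_nonneg _), ← ENNReal.ofReal_mul (by positivity)]
    congr 1
    have e : (r⁻¹ ^ 2) ^ ((1 / 2 : ℝ) - 1) = r := by
      rw [← Real.rpow_natCast, ← Real.rpow_mul h0.le]
      norm_num
      rw [Real.rpow_neg_one, inv_inv]
    rw [e, abs_neg, abs_of_pos (by positivity)]
    field_simp
  rw [setLIntegral_congr_fun measurableSet_Ioi hcongr, lintegral_const_mul _ (by fun_prop)] at h1
  rw [ENNReal.eq_inv_of_mul_eq_one_left ((mul_comm _ _).trans h1),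
    ← ENNReal.ofReal_inv_of_pos (by positivity), inv_div]

variable {m : ℕ}

theorem setOf_inner_mem_eq_normalize {w : EuclideanSpace ℝ (Fin (m + 1))} (hw : w ≠ 0) (a b : ℝ) :
    {y : sphere (0 : EuclideanSpace ℝ (Fin (m + 1))) 1 |
        ⟪(y : EuclideanSpace ℝ (Fin (m + 1))), w⟫ ∈ Icc a b} =
      {y : sphere (0 : EuclideanSpace ℝ (Fin (m + 1))) 1 |
        ⟪(y : EuclideanSpace ℝ (Fin (m + 1))), ‖w‖⁻¹ • w⟫ ∈ Icc (a / ‖w‖) (b / ‖w‖)} := by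
  have h : 0 < ‖w‖ := norm_pos_iff.2 hw
  ext y
  simp only [mem_ofPred_eq, mem_Icc, real_inner_smul_right, inv_mul_eq_div,
    div_le_div_iff_of_pos_right h]

/-- A bound for the measure of a slab by its width and a bound `c` for the density of the height. -/
theorem uniformSphere_slab_le (hm : 2 ≤ m) {w : EuclideanSpace ℝ (Fin (m + 1))} (hw : w ≠ 0)
    {a b c : ℝ}
    (hc : ∀ s ∈ Icc (a / ‖w‖) (b / ‖w‖) ∩ Ioo (-1) 1, (1 - s ^ 2) ^ (((m : ℝ) - 2) / 2) ≤ c)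
    (hc0 : 0 ≤ c) :
    uniformSphere (m + 1) {y | ⟪(y : EuclideanSpace ℝ (Fin (m + 1))), w⟫ ∈ Icc a b} ≤
      ENNReal.ofReal ((b - a) * (sphereArea m / sphereArea (m + 1) / ‖w‖ * c)) := by
  have h : 0 < ‖w‖ := norm_pos_iff.2 hw
  have hγ : 0 ≤ sphereArea m / sphereArea (m + 1) :=
    div_nonneg (sphereArea_nonneg _) (sphereArea_nonneg _)
  rw [setOf_inner_mem_eq_normalize hw,
    uniformSphere_inner_mem (by omega) (by simp [norm_smul, h.ne']) measurableSet_Icc]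
  calc _ ≤ ENNReal.ofReal (sphereArea m / sphereArea (m + 1)) *
        ∫⁻ s in Icc (a / ‖w‖) (b / ‖w‖) ∩ Ioo (-1) 1, ENNReal.ofReal c := by
        exact mul_le_mul' le_rfl (setLIntegral_mono measurable_const
          fun s hs => ENNReal.ofReal_le_ofReal (hc s hs))
    _ ≤ ENNReal.ofReal (sphereArea m / sphereArea (m + 1)) *
        (ENNReal.ofReal c * volume (Icc (a / ‖w‖) (b / ‖w‖))) := by
        rw [setLIntegral_const]
        gcongr
        exact inter_subset_left
    _ = _ := by
        rw [Real.volume_Icc, ← ENNReal.ofReal_mul hc0, ← ENNReal.ofReal_mul hγ]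
        congr 1
        field_simp

theorem heightDensity_le_one (hm : 2 ≤ m) {s : ℝ} (hs : s ∈ Ioo (-1 : ℝ) 1) :
    (1 - s ^ 2) ^ (((m : ℝ) - 2) / 2) ≤ 1 := by
  have : (2 : ℝ) ≤ m := by exact_mod_cast hm
  exact Real.rpow_le_one (by nlinarith [hs.1, hs.2]) (by nlinarith [sq_nonneg s]) (by linarith)

theorem uniformSphere_abs_one_sub_inner_le (hm : 2 ≤ m) {w : EuclideanSpace ℝ (Fin (m + 1))}
    (hw : w ≠ 0) (d : ℝ) :
    uniformSphere (m + 1) {y | |1 - ⟪(y : EuclideanSpace ℝ (Fin (m + 1))), w⟫| ≤ d} ≤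
      ENNReal.ofReal (2 * d * (sphereArea m / sphereArea (m + 1)) / ‖w‖) := by
  have h := uniformSphere_slab_le hm hw (a := 1 - d) (b := 1 + d) (c := 1)
    (fun s hs => heightDensity_le_one hm hs.2) zero_le_one
  convert h using 2
  · ext y
    simp only [mem_ofPred_eq, mem_Icc, abs_le]
    constructor <;> rintro ⟨h1, h2⟩ <;> constructor <;> linarith
  · ring_nf

/-- On the far side of the hyperplane `⟪·, w⟫ = 1`, the density of the height is at most its value
on this hyperplane; that makes the bound uniform in `ε`. -/
theorem uniformSphere_slab_above_one_le (hm : 2 ≤ m) {ε : ℝ} (hε : 0 < ε)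
    (w : EuclideanSpace ℝ (Fin (m + 1))) :
    uniformSphere (m + 1) {y | ⟪(y : EuclideanSpace ℝ (Fin (m + 1))), w⟫ ∈ Icc 1 (1 + ε)} ≤
      ENNReal.ofReal ε * (Ioi 1).indicator (fun r => ENNReal.ofReal
        (sphereArea m / sphereArea (m + 1) / r * (1 - r⁻¹ ^ 2) ^ (((m : ℝ) - 2) / 2))) ‖w‖ := by
  have hm' : (2 : ℝ) ≤ m := by exact_mod_cast hm
  by_cases hw1 : 1 < ‖w‖
  · rw [indicator_of_mem (mem_Ioi.2 hw1), ← ENNReal.ofReal_mul hε.le]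
    have hw : w ≠ 0 := norm_pos_iff.1 (by linarith)
    have hinv : ‖w‖⁻¹ < 1 := inv_lt_one_of_one_lt₀ hw1
    have hpos : 0 < ‖w‖⁻¹ := by positivity
    have h0 : 0 ≤ 1 - ‖w‖⁻¹ ^ 2 := by nlinarith
    have h := uniformSphere_slab_le hm hw (a := 1) (b := 1 + ε)
      (c := (1 - ‖w‖⁻¹ ^ 2) ^ (((m : ℝ) - 2) / 2)) (fun s hs => ?_) (by positivity)
    · rwa [add_sub_cancel_left] at h
    · have h1 : ‖w‖⁻¹ ≤ s := by simpa using hs.1.1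
      refine Real.rpow_le_rpow (by nlinarith [hs.2.1, hs.2.2]) (by nlinarith) (by linarith)
  · rw [indicator_of_notMem (by simpa using hw1), mul_zero, nonpos_iff_eq_zero]
    by_cases hw : w = 0
    · subst hw
      convert measure_empty (μ := uniformSphere (m + 1))
      ext y
      simp
    · rw [setOf_inner_mem_eq_normalize hw, uniformSphere_inner_mem (by omega)
        (by simp [norm_smul, hw]) measurableSet_Icc]
      have : Icc (1 / ‖w‖) ((1 + ε) / ‖w‖) ∩ Ioo (-1) 1 = ∅ := by
        rw [eq_empty_iff_forall_notMem]
        rintro s ⟨h1, h2⟩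
        have : 1 ≤ 1 / ‖w‖ := by
          rw [le_div_iff₀ (norm_pos_iff.2 hw)]; linarith
        linarith [h1.1, h2.2]
      rw [this]
      simp

/-- The integral over all hyperplanes, parametrized by their normal vectors `w`, of the `n`-th power
of the density of the height, with the weight `1 / ‖w‖`. -/
theorem lintegral_hyperplanes (hm : 2 ≤ m) {γ : ℝ} (hγ : 0 ≤ γ) :
    ∫⁻ w : EuclideanSpace ℝ (Fin (m + 1)), ENNReal.ofReal ‖w‖⁻¹ *
        ((Ioi 1).indicator (fun r => ENNReal.ofReal
          (γ / r * (1 - r⁻¹ ^ 2) ^ (((m : ℝ) - 2) / 2))) ‖w‖) ^ (m + 1) =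
      ENNReal.ofReal (sphereArea (m + 1) * γ ^ (m + 1) *
        (beta (1 / 2) (((m : ℝ) + 1) * (((m : ℝ) - 2) / 2) + 1) / 2)) := by
  have hm' : (2 : ℝ) ≤ m := by exact_mod_cast hm
  set q : ℝ := ((m : ℝ) - 2) / 2 with hq
  have hq0 : 0 ≤ q := by rw [hq]; linarith
  have hmeas : Measurable ((Ioi 1).indicator (fun r : ℝ => ENNReal.ofReal
      (γ / r * (1 - r⁻¹ ^ 2) ^ q))) :=
    Measurable.indicator (by fun_prop) measurableSet_Ioi
  rw [lintegral_fun_norm_addHaar (f := fun r => ENNReal.ofReal r⁻¹ *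
        ((Ioi 1).indicator (fun r => ENNReal.ofReal (γ / r * (1 - r⁻¹ ^ 2) ^ q)) r) ^ (m + 1)) _
    (by fun_prop)]
  have hcongr : ∀ r ∈ Ioi (0 : ℝ),
      ENNReal.ofReal (r ^ (finrank ℝ (EuclideanSpace ℝ (Fin (m + 1))) - 1)) *
      (ENNReal.ofReal r⁻¹ * ((Ioi 1).indicator (fun r => ENNReal.ofReal
        (γ / r * (1 - r⁻¹ ^ 2) ^ q)) r) ^ (m + 1)) =
      (Ioi 1).indicator (fun r => ENNReal.ofReal (γ ^ (m + 1)) * ENNReal.ofReal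
        (r⁻¹ ^ 2 * (1 - r⁻¹ ^ 2) ^ (((m : ℝ) + 1) * q + 1 - 1))) r := by
    intro r hr
    have hr : 0 < r := hr
    by_cases h : r ∈ Ioi 1
    · have h1 : 1 < r := h
      have hinv : r⁻¹ < 1 := inv_lt_one_of_one_lt₀ h1
      have hpos : 0 < r⁻¹ := by positivity
      have h0 : 0 ≤ 1 - r⁻¹ ^ 2 := by nlinarith
      rw [indicator_of_mem h, indicator_of_mem h, ← ENNReal.ofReal_pow (by positivity),
        ← ENNReal.ofReal_mul (by positivity), ← ENNReal.ofReal_mul (by positivity),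
        ← ENNReal.ofReal_mul (by positivity)]
      congr 1
      have e : (1 - r⁻¹ ^ 2) ^ (((m : ℝ) + 1) * q + 1 - 1) = ((1 - r⁻¹ ^ 2) ^ q) ^ (m + 1) := by
        rw [← Real.rpow_natCast ((1 - r⁻¹ ^ 2) ^ q), ← Real.rpow_mul h0]
        congr 1
        push_cast
        ring
      rw [e, finrank_euclideanSpace, Fintype.card_fin, Nat.add_sub_cancel, mul_pow, div_pow]
      field_simp
      ring
    · rw [indicator_of_notMem h, indicator_of_notMem h]
      simp
  rw [setLIntegral_congr_fun measurableSet_Ioi hcongr, lintegral_indicator measurableSet_Ioi,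
    Measure.restrict_restrict measurableSet_Ioi, Ioi_inter_Ioi, max_eq_left zero_le_one,
    lintegral_const_mul _ (by fun_prop), lintegral_inv_sq_eq_beta (by positivity), ← mul_assoc]
  change surfaceMeasure (m + 1) univ * _ * _ = _
  rw [surfaceMeasure_univ, ← ENNReal.ofReal_mul (sphereArea_nonneg _), ← ENNReal.ofReal_mul]
  exact mul_nonneg (sphereArea_nonneg _) (by positivity)

/-! ### The upper bound in dimension at least three -/

/-- The vectors `w` whose heights above the `v i` all lie in `[1, 1 + ε]`: a parallelepiped with
vertex `hyperplaneNormal v`. -/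
def normalBox {n : ℕ} (v : Fin n → EuclideanSpace ℝ (Fin n)) (ε : ℝ) :
    Set (EuclideanSpace ℝ (Fin n)) :=
  {w | ∀ i, ⟪v i, w⟫ ∈ Icc 1 (1 + ε)}

theorem isClosed_normalBox {n : ℕ} (ε : ℝ) :
    IsClosed {p : (Fin n → EuclideanSpace ℝ (Fin n)) × EuclideanSpace ℝ (Fin n) |
      p.2 ∈ normalBox p.1 ε} := by
  have : {p : (Fin n → EuclideanSpace ℝ (Fin n)) × EuclideanSpace ℝ (Fin n) |
      p.2 ∈ normalBox p.1 ε} = ⋂ i, (fun p => ⟪p.1 i, p.2⟫) ⁻¹' Icc 1 (1 + ε) := by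
    ext; simp [normalBox]
  rw [this]
  exact isClosed_iInter fun i => isClosed_Icc.preimage (by fun_prop)

theorem volume_normalBox {n : ℕ} {v : Fin n → EuclideanSpace ℝ (Fin n)}
    (hv : (rowMatrix v).det ≠ 0) {ε : ℝ} (hε : 0 ≤ ε) :
    volume (normalBox v ε) = ENNReal.ofReal (ε ^ n / |(rowMatrix v).det|) := by
  have hpres : MeasurePreserving (MeasurableEquiv.toLp 2 (Fin n → ℝ)).symm volume volume :=
    PiLp.volume_preserving_ofLp (Fin n)
  have hpre : normalBox v ε = (MeasurableEquiv.toLp 2 (Fin n → ℝ)).symm ⁻¹'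
      (Matrix.toLin' (rowMatrix v) ⁻¹' Icc 1 (fun _ => 1 + ε)) := by
    ext w
    simp only [normalBox, mem_ofPred_eq, mem_preimage, mem_Icc, Pi.le_def, ← forall_and,
      Matrix.toLin'_apply, Pi.one_apply]
    exact forall_congr' fun i => by rw [← rowMatrix_mulVec]; rfl
  rw [hpre, hpres.measure_preimage_equiv, Measure.addHaar_preimage_linearMap _
    (by rwa [LinearMap.det_toLin']), LinearMap.det_toLin', Real.volume_Icc_pi,
    ← ENNReal.ofReal_prod_of_nonneg (fun _ _ => by simpa using hε),
    ← ENNReal.ofReal_mul (abs_nonneg _)]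
  simp [abs_inv, inv_mul_eq_div]

theorem exists_norm_le_of_mem_normalBox {n : ℕ} {v : Fin n → EuclideanSpace ℝ (Fin n)}
    (hv : (rowMatrix v).det ≠ 0) :
    ∃ C : ℝ, 0 ≤ C ∧ ∀ ε, 0 ≤ ε → ∀ w ∈ normalBox v ε, ‖w‖ ≤ ‖hyperplaneNormal v‖ + C * ε := by
  let L : (Fin n → ℝ) →L[ℝ] EuclideanSpace ℝ (Fin n) := LinearMap.toContinuousLinearMap
    ((WithLp.linearEquiv 2 ℝ (Fin n → ℝ)).symm.toLinearMap ∘ₗ Matrix.toLin' (rowMatrix v)⁻¹)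
  refine ⟨‖L‖, norm_nonneg _, fun ε hε w hw => ?_⟩
  have hLw : w = hyperplaneNormal v + L ((rowMatrix v).mulVec w.ofLp - 1) := by
    have h1 : L ((rowMatrix v).mulVec w.ofLp) = w := by
      change WithLp.toLp 2 ((rowMatrix v)⁻¹.mulVec ((rowMatrix v).mulVec w.ofLp)) = w
      rw [Matrix.mulVec_mulVec, Matrix.nonsing_inv_mul _ hv.isUnit, Matrix.one_mulVec]
    rw [map_sub, h1]
    change w = hyperplaneNormal v + (w - hyperplaneNormal v)
    abel
  have hnorm : ‖(rowMatrix v).mulVec w.ofLp - 1‖ ≤ ε := by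
    rw [pi_norm_le_iff_of_nonneg hε]
    intro i
    have := hw i
    rw [Pi.sub_apply, rowMatrix_mulVec, Real.norm_eq_abs, abs_le, Pi.one_apply]
    constructor <;> linarith [this.1, this.2]
  calc ‖w‖ ≤ ‖hyperplaneNormal v‖ + ‖L ((rowMatrix v).mulVec w.ofLp - 1)‖ := by
        nth_rw 1 [hLw]; exact norm_add_le _ _
    _ ≤ _ := by
        gcongr
        exact (L.le_opNorm _).trans (by gcongr)

/-- The boxes shrink to their common vertex `hyperplaneNormal v`, so the means of `1 / ‖w‖` over
them approach its value there. -/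
theorem le_liminf_lintegral_normalBox {n : ℕ} {v : Fin n → EuclideanSpace ℝ (Fin n)}
    (hv : (rowMatrix v).det ≠ 0) (hv' : 0 < ‖hyperplaneNormal v‖) {ε : ℕ → ℝ} (hε : ∀ k, 0 < ε k)
    (hε0 : Tendsto ε atTop (𝓝 0)) :
    ENNReal.ofReal (1 / (|(rowMatrix v).det| * ‖hyperplaneNormal v‖)) ≤
      liminf (fun k => ENNReal.ofReal (ε k ^ n)⁻¹ *
        ∫⁻ w in normalBox v (ε k), ENNReal.ofReal ‖w‖⁻¹) atTop := by
  obtain ⟨C, hC, hle⟩ := exists_norm_le_of_mem_normalBox hv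
  have hdet : 0 < |(rowMatrix v).det| := abs_pos.2 hv
  have htend : Tendsto (fun k => ENNReal.ofReal
      (1 / (|(rowMatrix v).det| * (‖hyperplaneNormal v‖ + C * ε k)))) atTop
      (𝓝 (ENNReal.ofReal (1 / (|(rowMatrix v).det| * ‖hyperplaneNormal v‖)))) := by
    refine ENNReal.tendsto_ofReal ?_
    have : Tendsto (fun k => |(rowMatrix v).det| * (‖hyperplaneNormal v‖ + C * ε k)) atTop
        (𝓝 (|(rowMatrix v).det| * (‖hyperplaneNormal v‖ + C * 0))) :=
      ((hε0.const_mul C).const_add _).const_mul _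
    rw [mul_zero, add_zero] at this
    exact tendsto_const_nhds.div this (by positivity)
  rw [← htend.liminf_eq]
  refine liminf_le_liminf (.of_forall fun k => ?_)
  have hk := hε k
  have hmeas : MeasurableSet (normalBox v (ε k)) :=
    ((isClosed_normalBox (ε k)).preimage (f := fun w => (v, w)) (by fun_prop)).measurableSet
  calc ENNReal.ofReal (1 / (|(rowMatrix v).det| * (‖hyperplaneNormal v‖ + C * ε k)))
      = ENNReal.ofReal (ε k ^ n)⁻¹ * (ENNReal.ofReal (‖hyperplaneNormal v‖ + C * ε k)⁻¹ *
          volume (normalBox v (ε k))) := by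
        rw [volume_normalBox hv hk.le, ← ENNReal.ofReal_mul (by positivity),
          ← ENNReal.ofReal_mul (by positivity)]
        congr 1
        field_simp
    _ ≤ _ := by
        rw [← setLIntegral_const]
        refine mul_le_mul' le_rfl (setLIntegral_mono' hmeas fun w hw => ?_)
        refine ENNReal.ofReal_le_ofReal (inv_anti₀ ?_ (hle _ hk.le w hw))
        rw [norm_pos_iff]
        rintro rfl
        have hn : 0 < n := by
          by_contra h
          have h0 : n = 0 := by omega
          subst h0
          simp [Subsingleton.elim (hyperplaneNormal v) 0] at hv'
        have := (hw ⟨0, hn⟩).1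
        simp at this
        linarith

theorem isClosed_normalBox_sphere {n : ℕ} (ε : ℝ) :
    IsClosed {p : (Fin n → sphere (0 : EuclideanSpace ℝ (Fin n)) 1) × EuclideanSpace ℝ (Fin n) |
      p.2 ∈ normalBox (fun i => (p.1 i : EuclideanSpace ℝ (Fin n))) ε} :=
  (isClosed_normalBox ε).preimage
    (f := fun p : (Fin n → sphere (0 : EuclideanSpace ℝ (Fin n)) 1) × EuclideanSpace ℝ (Fin n) =>
      ((fun i => (p.1 i : EuclideanSpace ℝ (Fin n))), p.2))
    (((continuous_coe_pi_sphere _ _).comp continuous_fst).prodMk continuous_snd)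

theorem measurableSet_normalBox_sphere {n : ℕ}
    (v : Fin n → sphere (0 : EuclideanSpace ℝ (Fin n)) 1) (ε : ℝ) :
    MeasurableSet (normalBox (fun i => (v i : EuclideanSpace ℝ (Fin n))) ε) :=
  ((isClosed_normalBox_sphere ε).preimage (f := fun w => (v, w)) (by fun_prop)).measurableSet

theorem measurable_indicator_normalBox {n : ℕ} (ε : ℝ) :
    Measurable (fun p : (Fin n → sphere (0 : EuclideanSpace ℝ (Fin n)) 1) ×
        EuclideanSpace ℝ (Fin n) =>
      (normalBox (fun i => (p.1 i : EuclideanSpace ℝ (Fin n))) ε).indicator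
        (fun w => ENNReal.ofReal ‖w‖⁻¹) p.2) :=
  Measurable.indicator
    (f := fun p : (Fin n → sphere (0 : EuclideanSpace ℝ (Fin n)) 1) × EuclideanSpace ℝ (Fin n) =>
      ENNReal.ofReal ‖p.2‖⁻¹) (by fun_prop) (isClosed_normalBox_sphere ε).measurableSet


/-- After exchanging the order of integration, the independence of the points yields a power of the
measure of a slab. -/
theorem lintegral_normalBox_le (hm : 2 ≤ m) {ε : ℝ} (hε : 0 < ε) :
    ∫⁻ v, ENNReal.ofReal (ε ^ (m + 1))⁻¹ *
        (∫⁻ w in normalBox (fun i => (v i : EuclideanSpace ℝ (Fin (m + 1)))) ε,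
          ENNReal.ofReal ‖w‖⁻¹)
        ∂Measure.pi (fun _ : Fin (m + 1) => uniformSphere (m + 1)) ≤
      ENNReal.ofReal (sphereArea (m + 1) * (sphereArea m / sphereArea (m + 1)) ^ (m + 1) *
        (beta (1 / 2) (((m : ℝ) + 1) * (((m : ℝ) - 2) / 2) + 1) / 2)) := by
  have := isProbabilityMeasure_uniformSphere (n := m + 1) (by omega)
  set S := sphere (0 : EuclideanSpace ℝ (Fin (m + 1))) 1
  have hclosed := isClosed_normalBox_sphere (n := m + 1) ε
  rw [← lintegral_hyperplanes hm (div_nonneg (sphereArea_nonneg _) (sphereArea_nonneg _))]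
  have hjoint := measurable_indicator_normalBox (n := m + 1) ε
  simp only [← lintegral_indicator (measurableSet_normalBox_sphere _ ε)]
  rw [lintegral_const_mul _ hjoint.lintegral_prod_right',
    lintegral_lintegral_swap hjoint.aemeasurable,
    ← lintegral_const_mul _ hjoint.lintegral_prod_left']
  refine lintegral_mono fun w => ?_
  have hbox_pi : ∫⁻ v : Fin (m + 1) → S,
      (normalBox (fun i => (v i : EuclideanSpace ℝ (Fin (m + 1)))) ε).indicator
        (fun w => ENNReal.ofReal ‖w‖⁻¹) w ∂Measure.pi (fun _ => uniformSphere (m + 1)) =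
      ENNReal.ofReal ‖w‖⁻¹ *
        uniformSphere (m + 1) {y | ⟪(y : EuclideanSpace ℝ (Fin (m + 1))), w⟫ ∈ Icc 1 (1 + ε)} ^
          (m + 1) := by
    have hset : {v : Fin (m + 1) → S |
        w ∈ normalBox (fun i => (v i : EuclideanSpace ℝ (Fin (m + 1)))) ε} =
        Set.pi univ fun _ =>
          {y : S | ⟪(y : EuclideanSpace ℝ (Fin (m + 1))), w⟫ ∈ Icc 1 (1 + ε)} := by
      ext v; simp [normalBox]
    calc _ = ∫⁻ v, {v : Fin (m + 1) → S |
          w ∈ normalBox (fun i => (v i : EuclideanSpace ℝ (Fin (m + 1)))) ε}.indicator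
            (fun _ => ENNReal.ofReal ‖w‖⁻¹) v ∂Measure.pi (fun _ => uniformSphere (m + 1)) := rfl
      _ = _ := by
        have hmeas : MeasurableSet {v : Fin (m + 1) → S |
            w ∈ normalBox (fun i => (v i : EuclideanSpace ℝ (Fin (m + 1)))) ε} :=
          (hclosed.preimage (f := fun v => (v, w)) (by fun_prop)).measurableSet
        rw [lintegral_indicator_const hmeas, hset, Measure.pi_pi,
          Finset.prod_const, Finset.card_univ, Fintype.card_fin]
  rw [hbox_pi, mul_left_comm]
  refine mul_le_mul' le_rfl ?_
  calc ENNReal.ofReal (ε ^ (m + 1))⁻¹ * uniformSphere (m + 1)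
        {y | ⟪(y : EuclideanSpace ℝ (Fin (m + 1))), w⟫ ∈ Icc 1 (1 + ε)} ^ (m + 1)
      = (ENNReal.ofReal ε⁻¹ * uniformSphere (m + 1)
        {y | ⟪(y : EuclideanSpace ℝ (Fin (m + 1))), w⟫ ∈ Icc 1 (1 + ε)}) ^ (m + 1) := by
        rw [mul_pow, ← ENNReal.ofReal_pow (by positivity), inv_pow]
    _ ≤ _ := by
        refine pow_le_pow_left' ?_ _
        refine (mul_le_mul' le_rfl (uniformSphere_slab_above_one_le hm hε w)).trans ?_
        rw [← mul_assoc, ← ENNReal.ofReal_mul (by positivity), inv_mul_cancel₀ hε.ne',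
          ENNReal.ofReal_one, one_mul]

/-- An upper bound for the mean of `1 / (|det X| ‖w‖)`, where `w` is the normalized normal vector
of the hyperplane through the random points that form the rows of `X`. -/
theorem lintegral_one_div_det_mul_norm_le (hm : 2 ≤ m) :
    ∫⁻ v, ENNReal.ofReal (1 /
        (|(rowMatrix fun i => (v i : EuclideanSpace ℝ (Fin (m + 1)))).det| *
          ‖hyperplaneNormal fun i => (v i : EuclideanSpace ℝ (Fin (m + 1)))‖))
        ∂Measure.pi (fun _ : Fin (m + 1) => uniformSphere (m + 1)) ≤
      ENNReal.ofReal (sphereArea (m + 1) * (sphereArea m / sphereArea (m + 1)) ^ (m + 1) *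
        (beta (1 / 2) (((m : ℝ) + 1) * (((m : ℝ) - 2) / 2) + 1) / 2)) := by
  set S := sphere (0 : EuclideanSpace ℝ (Fin (m + 1))) 1
  have hε : ∀ k : ℕ, (0 : ℝ) < 1 / ((k : ℝ) + 1) := fun k => by positivity
  calc _ ≤ ∫⁻ v : Fin (m + 1) → S, liminf (fun k : ℕ =>
          ENNReal.ofReal ((1 / ((k : ℝ) + 1)) ^ (m + 1))⁻¹ *
          ∫⁻ w in normalBox (fun i => (v i : EuclideanSpace ℝ (Fin (m + 1)))) (1 / ((k : ℝ) + 1)),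
            ENNReal.ofReal ‖w‖⁻¹) atTop
          ∂Measure.pi (fun _ : Fin (m + 1) => uniformSphere (m + 1)) := by
        refine lintegral_mono_ae ?_
        filter_upwards [ae_det_rowMatrix_ne_zero (m := m) (by omega)] with v hv
        exact le_liminf_lintegral_normalBox hv
          (zero_lt_one.trans_le (one_le_norm_hyperplaneNormal hv)) hε
          tendsto_one_div_add_atTop_nhds_zero_nat
    _ ≤ liminf (fun k : ℕ => ∫⁻ v : Fin (m + 1) → S,
          ENNReal.ofReal ((1 / ((k : ℝ) + 1)) ^ (m + 1))⁻¹ *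
          (∫⁻ w in normalBox (fun i => (v i : EuclideanSpace ℝ (Fin (m + 1)))) (1 / ((k : ℝ) + 1)),
            ENNReal.ofReal ‖w‖⁻¹)
          ∂Measure.pi (fun _ : Fin (m + 1) => uniformSphere (m + 1))) atTop := by
        refine lintegral_liminf_le fun k => ?_
        simp only [← lintegral_indicator (measurableSet_normalBox_sphere _ _)]
        exact (measurable_indicator_normalBox _).lintegral_prod_right'.const_mul _
    _ ≤ _ := by
        refine liminf_le_of_le (by isBoundedDefault) fun b hb => ?_
        obtain ⟨k, hk⟩ := hb.exists
        exact hk.trans (lintegral_normalBox_le hm (hε k))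

theorem pi_simplexVol_le_upper (hm : 2 ≤ m) {t : ℝ} (ht : 0 ≤ t) :
    Measure.pi (fun _ : Fin (m + 1 + 1) => uniformSphere (m + 1)) {x | simplexVol x ≤ t} ≤
      ENNReal.ofReal (upperConst (m + 1) * t) := by
  have hγ : 0 ≤ sphereArea m / sphereArea (m + 1) :=
    div_nonneg (sphereArea_nonneg _) (sphereArea_nonneg _)
  have hS : 0 < sphereArea (m + 1) := sphereArea_pos (by omega)
  rw [pi_simplexVol_le (by omega)]
  calc _ ≤ ∫⁻ v, ENNReal.ofReal (2 * ((m + 1)! * t) * (sphereArea m / sphereArea (m + 1))) *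
        ENNReal.ofReal (1 /
          (|(rowMatrix fun i => (v i : EuclideanSpace ℝ (Fin (m + 1)))).det| *
          ‖hyperplaneNormal fun i => (v i : EuclideanSpace ℝ (Fin (m + 1)))‖))
        ∂Measure.pi (fun _ : Fin (m + 1) => uniformSphere (m + 1)) := by
        refine lintegral_mono_ae ?_
        filter_upwards [ae_det_rowMatrix_ne_zero (m := m) (by omega)] with v hv
        have hdet := abs_pos.2 hv
        have hw := zero_lt_one.trans_le (one_le_norm_hyperplaneNormal hv)
        have h := uniformSphere_abs_one_sub_inner_le hm (norm_pos_iff.1 hw)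
          ((m + 1)! * t / |(rowMatrix fun i => (v i : EuclideanSpace ℝ (Fin (m + 1)))).det|)
        simp only [le_div_iff₀' hdet] at h
        refine h.trans_eq ?_
        rw [← ENNReal.ofReal_mul (by positivity)]
        congr 1
        field_simp
    _ ≤ _ := by
        rw [lintegral_const_mul' _ _ ENNReal.ofReal_ne_top]
        refine (mul_le_mul' le_rfl (lintegral_one_div_det_mul_norm_le hm)).trans_eq ?_
        rw [← ENNReal.ofReal_mul (by positivity), upperConst]
        have e : ((((m + 1 : ℕ) : ℝ) ^ 2 - 3 * ((m + 1 : ℕ) : ℝ) + 2) / 2) =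
            ((m : ℝ) + 1) * (((m : ℝ) - 2) / 2) + 1 := by
          push_cast; ring
        rw [e, Nat.add_sub_cancel]
        congr 1
        rw [div_pow]
        field_simp
        ring

/-! ### The lower bound in dimension at least three -/

/-- A closed hemisphere and its antipode cover the sphere, so that it has measure at least
`1 / 2`. -/
theorem half_le_lintegral_height (hm : 1 ≤ m) :
    1 / 2 ≤ ENNReal.ofReal (sphereArea m / sphereArea (m + 1)) *
      ∫⁻ s in Ico (0 : ℝ) 1, ENNReal.ofReal ((1 - s ^ 2) ^ (((m : ℝ) - 2) / 2)) := by
  have := isProbabilityMeasure_uniformSphere (n := m + 1) (by omega)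
  let u : EuclideanSpace ℝ (Fin (m + 1)) := EuclideanSpace.single 0 1
  have hu : ‖u‖ = 1 := by simp [u]
  have hset : Ici (0 : ℝ) ∩ Ioo (-1) 1 = Ico 0 1 := by
    ext s; simp only [mem_inter_iff, mem_Ici, mem_Ioo, mem_Ico]
    constructor
    · rintro ⟨h0, -, h1⟩; exact ⟨h0, h1⟩
    · rintro ⟨h0, h1⟩; exact ⟨h0, by linarith, h1⟩
  have h1 := uniformSphere_inner_mem hm hu (measurableSet_Ici (a := (0 : ℝ)))
  have h2 := uniformSphere_inner_mem hm (u := -u) (by rwa [norm_neg])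
    (measurableSet_Ici (a := (0 : ℝ)))
  rw [hset] at h1 h2
  have hcover : (univ : Set (sphere (0 : EuclideanSpace ℝ (Fin (m + 1))) 1)) ⊆
      {y | ⟪(y : EuclideanSpace ℝ (Fin (m + 1))), u⟫ ∈ Ici 0} ∪
      {y | ⟪(y : EuclideanSpace ℝ (Fin (m + 1))), -u⟫ ∈ Ici 0} := by
    intro y _
    simp only [mem_union, mem_ofPred_eq, mem_Ici, inner_neg_right]
    rcases le_total 0 ⟪(y : EuclideanSpace ℝ (Fin (m + 1))), u⟫ with h | h
    · exact .inl h
    · exact .inr (by linarith)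
  have h3 := (measure_mono (μ := uniformSphere (m + 1)) hcover).trans (measure_union_le _ _)
  rw [measure_univ, h1, h2, ← two_mul] at h3
  rw [ENNReal.div_le_iff_le_mul (by simp) (by simp), mul_comm]
  exact h3

theorem half_le_sphereArea_div (hm : 2 ≤ m) : 1 / 2 ≤ sphereArea m / sphereArea (m + 1) := by
  have h := half_le_lintegral_height (m := m) (by omega)
  have h1 : ∫⁻ s in Ico (0 : ℝ) 1, ENNReal.ofReal ((1 - s ^ 2) ^ (((m : ℝ) - 2) / 2)) ≤ 1 := by
    calc _ ≤ ∫⁻ s in Ico (0 : ℝ) 1, 1 := by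
          refine setLIntegral_mono measurable_const fun s hs => ?_
          rw [ENNReal.ofReal_le_one]
          exact heightDensity_le_one hm ⟨by linarith [hs.1], hs.2⟩
      _ = 1 := by simp
  have h2 := h.trans (mul_le_mul' le_rfl h1)
  rw [mul_one] at h2
  have h3 : (1 / 2 : ℝ≥0∞) = ENNReal.ofReal (1 / 2) := by
    rw [ENNReal.ofReal_div_of_pos two_pos]; simp
  rw [h3] at h2
  exact (ENNReal.ofReal_le_ofReal_iff
    (div_nonneg (sphereArea_nonneg _) (sphereArea_nonneg _))).1 h2

/-- The density of the height decreases on `[0, 1)`. -/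
theorem mul_lintegral_height_le (hm : 2 ≤ m) {d : ℝ} (hd : 0 ≤ d) (hd1 : d ≤ 1) :
    ENNReal.ofReal d * ∫⁻ s in Ico (0 : ℝ) 1, ENNReal.ofReal ((1 - s ^ 2) ^ (((m : ℝ) - 2) / 2)) ≤
      ∫⁻ s in Ico (0 : ℝ) d, ENNReal.ofReal ((1 - s ^ 2) ^ (((m : ℝ) - 2) / 2)) := by
  have hm' : (2 : ℝ) ≤ m := by exact_mod_cast hm
  rcases hd.eq_or_lt with rfl | hd
  · simp
  have himage : (fun s : ℝ => d * s) '' Ico 0 1 = Ico 0 d := by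
    rw [image_mul_left_Ico hd]; simp
  rw [← himage, lintegral_image_eq_lintegral_abs_deriv_mul (f' := fun _ => d) measurableSet_Ico
    (fun s _ => by simpa using ((hasDerivAt_id s).const_mul d).hasDerivWithinAt)
    ((mul_right_injective₀ hd.ne').injOn), ← lintegral_const_mul _ (by fun_prop)]
  refine setLIntegral_mono (by fun_prop) fun s hs => ?_
  rw [abs_of_pos hd]
  have h1 : d * s ≤ s := mul_le_of_le_one_left hs.1 hd1
  have h2 : 0 ≤ d * s := mul_nonneg hd.le hs.1
  have h3 : (d * s) ^ 2 ≤ s ^ 2 := pow_le_pow_left₀ h2 h1 2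
  have h4 : s ^ 2 < 1 := by nlinarith [hs.1, hs.2]
  gcongr

/-- Hadamard's inequality for the edges from the point that lies at the same distance `ρ` from the
hyperplane through the `x i` as these points lie from their circumcentre. -/
theorem abs_det_mul_norm_le (hm : 1 ≤ m)
    {x : Fin (m + 1) → sphere (0 : EuclideanSpace ℝ (Fin (m + 1))) 1}
    (hx : (rowMatrix fun i => (x i : EuclideanSpace ℝ (Fin (m + 1)))).det ≠ 0)
    {w : EuclideanSpace ℝ (Fin (m + 1))}
    (hw : ∀ i, ⟪(x i : EuclideanSpace ℝ (Fin (m + 1))), w⟫ = 1) :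
    ‖w‖⁻¹ < 1 ∧ |(rowMatrix fun i => (x i : EuclideanSpace ℝ (Fin (m + 1)))).det| * ‖w‖ ≤
      √2 ^ (m + 1) * √(1 - ‖w‖⁻¹ ^ 2) ^ m := by
  have hnorm : ∀ i, ‖(x i : EuclideanSpace ℝ (Fin (m + 1)))‖ = 1 := fun i => by simp
  have hle : 1 ≤ ‖w‖ := by
    have h := real_inner_le_norm (x 0 : EuclideanSpace ℝ (Fin (m + 1))) w
    rw [hw 0] at h
    simpa using h
  have hpos : 0 < ‖w‖ := by linarith
  have hlt : 1 < ‖w‖ := by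
    refine lt_of_le_of_ne hle fun h => hx ?_
    have h1 : ∀ i, (x i : EuclideanSpace ℝ (Fin (m + 1))) = w := fun i =>
      (inner_eq_one_iff_of_norm_eq_one (𝕜 := ℝ) (hnorm i) h.symm).1 (hw i)
    refine Matrix.det_zero_of_row_eq (i := 0) (j := Fin.last m) ?_ ?_
    · simp [Fin.ext_iff]; omega
    · ext j; simp [h1]
  have hinv : ‖w‖⁻¹ < 1 := inv_lt_one_of_one_lt₀ hlt
  refine ⟨hinv, ?_⟩
  have hinv0 : 0 < ‖w‖⁻¹ := by positivity
  have hρ2 : 0 < 1 - ‖w‖⁻¹ ^ 2 := by nlinarith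
  set ρ := √(1 - ‖w‖⁻¹ ^ 2) with hρ
  have hρ0 : 0 < ρ := Real.sqrt_pos.2 hρ2
  have hρsq : ρ ^ 2 = 1 - ‖w‖⁻¹ ^ 2 := Real.sq_sqrt hρ2.le
  set c := (‖w‖⁻¹ + ρ) * ‖w‖⁻¹ with hc
  have hedge : ∀ i, ‖(x i : EuclideanSpace ℝ (Fin (m + 1))) - c • w‖ = √2 * ρ := by
    intro i
    rw [← sq_eq_sq₀ (norm_nonneg _) (by positivity), norm_sub_sq_real, hnorm, norm_smul,
      real_inner_smul_right, hw, mul_pow, mul_pow, Real.sq_sqrt zero_le_two, Real.norm_eq_abs,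
      sq_abs, hρsq, hc]
    have : ((‖w‖⁻¹ + ρ) * ‖w‖⁻¹) ^ 2 * ‖w‖ ^ 2 = (‖w‖⁻¹ + ρ) ^ 2 := by field_simp
    rw [this]
    linear_combination hρsq
  have h1 := abs_det_rowMatrix_le fun i => (x i : EuclideanSpace ℝ (Fin (m + 1))) - c • w
  rw [det_rowMatrix_sub hx hw, abs_mul] at h1
  simp only [hedge, Finset.prod_const, Finset.card_univ, Fintype.card_fin] at h1
  have h2 : |1 - ⟪c • w, w⟫| = ‖w‖ * ρ := by
    rw [real_inner_smul_left, real_inner_self_eq_norm_sq]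
    have : 1 - c * ‖w‖ ^ 2 = -(‖w‖ * ρ) := by rw [hc]; field_simp; ring
    rw [this, abs_neg, abs_of_pos (by positivity)]
  rw [h2, mul_pow, pow_succ ρ, ← mul_assoc, ← mul_assoc] at h1
  exact le_of_mul_le_mul_right h1 hρ0

/-- A lower bound, uniform in the hyperplane `⟪·, w⟫ = 1`, for the measure of the slab around it:
when the hyperplane is far from the centre, the density of the height is small there, but the points
`x i` are close together and so the slab is wide. -/
theorem le_uniformSphere_slab (hm : 2 ≤ m)
    {x : Fin (m + 1) → sphere (0 : EuclideanSpace ℝ (Fin (m + 1))) 1}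
    (hx : (rowMatrix fun i => (x i : EuclideanSpace ℝ (Fin (m + 1)))).det ≠ 0)
    {w : EuclideanSpace ℝ (Fin (m + 1))}
    (hw : ∀ i, ⟪(x i : EuclideanSpace ℝ (Fin (m + 1))), w⟫ = 1) {τ : ℝ} (hτ : 0 ≤ τ) :
    ENNReal.ofReal (min (τ / (2 * √2 ^ (m + 1))) (1 / 2)) ≤ uniformSphere (m + 1)
        {y | |(rowMatrix fun i => (x i : EuclideanSpace ℝ (Fin (m + 1)))).det| *
          |1 - ⟪(y : EuclideanSpace ℝ (Fin (m + 1))), w⟫| ≤ τ} := by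
  have hm' : (2 : ℝ) ≤ m := by exact_mod_cast hm
  obtain ⟨hinv, hdet⟩ := abs_det_mul_norm_le (by omega) hx hw
  have hw0 : w ≠ 0 := by
    rintro rfl
    simpa using hw 0
  have hpos : 0 < ‖w‖ := norm_pos_iff.2 hw0
  have hinv0 : 0 < ‖w‖⁻¹ := by positivity
  have hρ2 : 0 < 1 - ‖w‖⁻¹ ^ 2 := by nlinarith
  set D := |(rowMatrix fun i => (x i : EuclideanSpace ℝ (Fin (m + 1)))).det| with hD
  have hD0 : 0 < D := abs_pos.2 hx
  set h := ‖w‖⁻¹ with hh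
  set ρ := √(1 - h ^ 2) with hρ
  have hρ0 : 0 < ρ := Real.sqrt_pos.2 hρ2
  have hρsq : ρ ^ 2 = 1 - h ^ 2 := Real.sq_sqrt hρ2.le
  have hρ1 : ρ ≤ 1 := by nlinarith
  set K := √2 ^ (m + 1) with hK
  have hK0 : 0 < K := by positivity
  set d := τ / (D * ‖w‖) with hd
  have hd0 : 0 ≤ d := by positivity
  have hdle : τ / (K * ρ ^ m) ≤ d := div_le_div_of_nonneg_left hτ (by positivity) hdet
  set γ := sphereArea m / sphereArea (m + 1) with hγ
  have hγ2 : 1 / 2 ≤ γ := half_le_sphereArea_div hm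
  have hslab : ∀ A : Set ℝ, MeasurableSet A → A ⊆ Icc (h - d) (h + d) →
      ENNReal.ofReal γ *
        ∫⁻ s in A ∩ Ioo (-1) 1, ENNReal.ofReal ((1 - s ^ 2) ^ (((m : ℝ) - 2) / 2)) ≤
      uniformSphere (m + 1)
        {y | D * |1 - ⟪(y : EuclideanSpace ℝ (Fin (m + 1))), w⟫| ≤ τ} := by
    intro A hA hsub
    rw [← uniformSphere_inner_mem (by omega) (u := ‖w‖⁻¹ • w) (by simp [norm_smul, hw0]) hA]
    refine measure_mono fun y hy => ?_
    have hy := hsub hy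
    rw [real_inner_smul_right, mem_Icc] at hy
    have h1 : |1 - ⟪(y : EuclideanSpace ℝ (Fin (m + 1))), w⟫| ≤ ‖w‖ * d := by
      have e : 1 - ⟪(y : EuclideanSpace ℝ (Fin (m + 1))), w⟫ =
          ‖w‖ * (h - ‖w‖⁻¹ * ⟪(y : EuclideanSpace ℝ (Fin (m + 1))), w⟫) := by
        rw [hh]; field_simp
      rw [e, abs_mul, abs_of_pos hpos]
      gcongr
      rw [abs_le]
      constructor <;> linarith [hy.1, hy.2]
    calc D * |1 - ⟪(y : EuclideanSpace ℝ (Fin (m + 1))), w⟫| ≤ D * (‖w‖ * d) := by gcongr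
      _ = τ := by rw [hd]; field_simp
  rcases le_or_gt d h with hdh | hdh
  · -- the slab reaches inwards from the hyperplane, where the density is at least that at `h`
    refine le_trans ?_ (hslab (Icc (h - d) h) measurableSet_Icc
      (Icc_subset_Icc_right (by linarith)))
    have hsub : Icc (h - d) h ∩ Ioo (-1) 1 = Icc (h - d) h :=
      inter_eq_left.2 fun s hs => ⟨by linarith [hs.1], by linarith [hs.2]⟩
    rw [hsub]
    calc ENNReal.ofReal (min (τ / (2 * K)) (1 / 2))
        ≤ ENNReal.ofReal (γ * (ρ ^ (m - 2) * d)) := by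
          refine ENNReal.ofReal_le_ofReal ((min_le_left _ _).trans ?_)
          calc τ / (2 * K) = 1 / 2 * (τ / K) := by field_simp
            _ ≤ γ * (τ / (K * ρ ^ 2)) := by
              gcongr
              exact mul_le_of_le_one_right hK0.le (pow_le_one₀ hρ0.le hρ1)
            _ = γ * (ρ ^ (m - 2) * (τ / (K * ρ ^ m))) := by
              have : ρ ^ m = ρ ^ (m - 2) * ρ ^ 2 := by rw [← pow_add]; congr 1; omega
              rw [this]
              field_simp
            _ ≤ _ := by gcongr
      _ = ENNReal.ofReal γ * ∫⁻ s in Icc (h - d) h, ENNReal.ofReal (ρ ^ (m - 2)) := by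
          rw [setLIntegral_const, Real.volume_Icc, ← ENNReal.ofReal_mul (by positivity),
            ← ENNReal.ofReal_mul (by positivity)]
          congr 2
          ring
      _ ≤ _ := by
          refine mul_le_mul' le_rfl (setLIntegral_mono (by fun_prop) fun s hs => ?_)
          refine ENNReal.ofReal_le_ofReal ?_
          have e : ρ ^ (m - 2) = (1 - h ^ 2) ^ (((m : ℝ) - 2) / 2) := by
            rw [← hρsq, ← Real.rpow_natCast ρ 2, ← Real.rpow_mul hρ0.le, ← Real.rpow_natCast]
            congr 1
            push_cast [Nat.cast_sub hm]
            ring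
          rw [e]
          have h0 : 0 ≤ s := by linarith [hs.1]
          exact Real.rpow_le_rpow hρ2.le (by nlinarith [hs.2]) (by linarith)
  · -- the slab contains a slab that starts at the centre
    refine le_trans ?_ (hslab (Ico 0 (min d 1)) measurableSet_Ico fun s hs =>
      ⟨by linarith [hs.1], by linarith [hs.2, min_le_left d 1]⟩)
    have hsub : Ico 0 (min d 1) ∩ Ioo (-1) 1 = Ico 0 (min d 1) :=
      inter_eq_left.2 fun s hs => ⟨by linarith [hs.1], hs.2.trans_le (min_le_right _ _)⟩
    have hmin0 : 0 ≤ min d 1 := le_min hd0 zero_le_one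
    rw [hsub]
    calc ENNReal.ofReal (min (τ / (2 * K)) (1 / 2))
        ≤ ENNReal.ofReal (min d 1 * (1 / 2)) := by
          refine ENNReal.ofReal_le_ofReal ?_
          rw [min_mul_of_nonneg _ _ (by norm_num), one_mul]
          refine min_le_min_right _ ?_
          calc τ / (2 * K) = τ / K * (1 / 2) := by field_simp
            _ ≤ τ / (K * ρ ^ m) * (1 / 2) := by
              gcongr
              exact mul_le_of_le_one_right hK0.le (pow_le_one₀ hρ0.le hρ1)
            _ ≤ _ := by gcongr
      _ = ENNReal.ofReal (min d 1) * (1 / 2) := by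
          rw [ENNReal.ofReal_mul hmin0, ENNReal.ofReal_div_of_pos two_pos]
          simp
      _ ≤ ENNReal.ofReal (min d 1) * (ENNReal.ofReal γ * ∫⁻ s in Ico (0 : ℝ) 1,
            ENNReal.ofReal ((1 - s ^ 2) ^ (((m : ℝ) - 2) / 2))) :=
          mul_le_mul' le_rfl (half_le_lintegral_height (by omega))
      _ ≤ _ := by
          rw [mul_left_comm]
          exact mul_le_mul' le_rfl (mul_lintegral_height_le hm hmin0 (min_le_right _ _))

theorem min_le_pi_simplexVol_le (hm : 2 ≤ m) {t : ℝ} (ht : 0 ≤ t) :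
    ENNReal.ofReal (min ((m + 1)! * t / (2 * √2 ^ (m + 1))) (1 / 2)) ≤
      Measure.pi (fun _ : Fin (m + 1 + 1) => uniformSphere (m + 1)) {x | simplexVol x ≤ t} := by
  have := isProbabilityMeasure_uniformSphere (n := m + 1) (by omega)
  rw [pi_simplexVol_le (by omega)]
  calc _ = ∫⁻ _, ENNReal.ofReal (min ((m + 1)! * t / (2 * √2 ^ (m + 1))) (1 / 2))
        ∂Measure.pi (fun _ : Fin (m + 1) => uniformSphere (m + 1)) := by
        rw [lintegral_const, measure_univ, mul_one]
    _ ≤ _ := by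
        refine lintegral_mono_ae ?_
        filter_upwards [ae_det_rowMatrix_ne_zero (m := m) (by omega)] with v hv
        exact le_uniformSphere_slab hm hv (inner_hyperplaneNormal hv) (by positivity)

/-! ### The constants -/

theorem ballVol_eq {n : ℕ} (hn : 1 ≤ n) :
    ballVol n = √Real.pi ^ n / Real.Gamma ((n : ℝ) / 2 + 1) := by
  have : Nonempty (Fin n) := ⟨⟨0, hn⟩⟩
  have hG : 0 < Real.Gamma ((n : ℝ) / 2 + 1) := Real.Gamma_pos_of_pos (by positivity)
  rw [ballVol, Measure.real, EuclideanSpace.volume_ball]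
  simp only [ENNReal.ofReal_one, one_pow, one_mul, Fintype.card_fin]
  exact ENNReal.toReal_ofReal (by positivity)

theorem sphereArea_eq_gamma {n : ℕ} (hn : 1 ≤ n) :
    sphereArea n = 2 * √Real.pi ^ n / Real.Gamma ((n : ℝ) / 2) := by
  have hn0 : (n : ℝ) / 2 ≠ 0 := by positivity
  have hG : 0 < Real.Gamma ((n : ℝ) / 2) := Real.Gamma_pos_of_pos (by positivity)
  rw [sphereArea_eq, ballVol_eq hn, Real.Gamma_add_one hn0]
  field_simp

/-- Log-convexity of the Gamma function. -/
theorem gamma_add_half_le {x : ℝ} (hx : 0 < x) :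
    Real.Gamma (x + 1 / 2) ≤ √x * Real.Gamma x := by
  have h := Real.Gamma_mul_add_mul_le_rpow_Gamma_mul_rpow_Gamma hx (show 0 < x + 1 by linarith)
    (show (0 : ℝ) < 1 / 2 by norm_num) (show (0 : ℝ) < 1 / 2 by norm_num) (by norm_num)
  have hG := Real.Gamma_pos_of_pos hx
  rw [Real.Gamma_add_one hx.ne', Real.mul_rpow hx.le hG.le, ← Real.sqrt_eq_rpow,
    ← Real.sqrt_eq_rpow, mul_left_comm, Real.mul_self_sqrt hG.le] at h
  convert h using 2
  ring

/-- The powers of `Γ((n-1)/2) / Γ(n/2)` in `a_n` cancel against those in the sphere areas. -/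
theorem lowerConst_eq {m : ℕ} (hm : 1 ≤ m) :
    lowerConst (m + 1) = 1 / ballVol (m + 1) *
      (2 / (√(Real.exp 1) * √((m : ℝ) + 1) * ((m : ℝ) + 1) ^ 2 * Real.pi) *
      (Real.Gamma (((m : ℝ) ^ 2 + 1) / 2) / Real.Gamma ((m : ℝ) ^ 2 / 2)) *
      (Real.Gamma (((m : ℝ) + 1) / 2) / Real.Gamma ((m : ℝ) / 2))) := by
  have hm0 : (0 : ℝ) < m := by exact_mod_cast hm
  have hG1 : 0 < Real.Gamma ((m : ℝ) / 2) := Real.Gamma_pos_of_pos (by positivity)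
  have hG2 : 0 < Real.Gamma (((m : ℝ) + 1) / 2) := Real.Gamma_pos_of_pos (by positivity)
  have hG3 : 0 < Real.Gamma ((m : ℝ) ^ 2 / 2) := Real.Gamma_pos_of_pos (by positivity)
  have hπ : 0 < √Real.pi := Real.sqrt_pos.2 Real.pi_pos
  have hππ : Real.pi = √Real.pi ^ 2 := (Real.sq_sqrt Real.pi_pos.le).symm
  rw [lowerConst, Nat.add_sub_cancel, sphereArea_eq_gamma hm, sphereArea_eq_gamma (by omega),
    Real.Gamma_one_half_eq]
  push_cast
  rw [add_sub_cancel_right]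
  congr 1
  have he : 0 < √(Real.exp 1) := Real.sqrt_pos.2 (Real.exp_pos 1)
  have hs : 0 < √((m : ℝ) + 1) := by positivity
  rw [show 2 / (√(Real.exp 1) * √((m : ℝ) + 1) * ((m : ℝ) + 1) ^ 2 * Real.pi) =
    2 / (√(Real.exp 1) * √((m : ℝ) + 1) * ((m : ℝ) + 1) ^ 2 * √Real.pi ^ 2) by rw [← hππ]]
  generalize √Real.pi = p at *
  generalize Real.Gamma ((m : ℝ) / 2) = a at *
  generalize Real.Gamma (((m : ℝ) + 1) / 2) = b at *
  simp only [div_pow, mul_pow, ← pow_mul]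
  field_simp
  ring

theorem lowerConst_mul_ballVol_le {m : ℕ} (hm : 2 ≤ m) :
    lowerConst (m + 1) * ballVol (m + 1) ≤ 1 / 2 := by
  have hm0 : (2 : ℝ) ≤ m := by exact_mod_cast hm
  have hG1 : 0 < Real.Gamma ((m : ℝ) / 2) := Real.Gamma_pos_of_pos (by positivity)
  have hG3 : 0 < Real.Gamma ((m : ℝ) ^ 2 / 2) := Real.Gamma_pos_of_pos (by positivity)
  have hB := ballVol_pos (m + 1)
  have hπ := Real.pi_gt_three
  have h1 : Real.Gamma (((m : ℝ) ^ 2 + 1) / 2) / Real.Gamma ((m : ℝ) ^ 2 / 2) ≤ (m : ℝ) + 1 := by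
    rw [div_le_iff₀ hG3, add_div]
    refine (gamma_add_half_le (by positivity)).trans ?_
    gcongr
    rw [Real.sqrt_le_left (by positivity)]
    nlinarith
  have h2 : Real.Gamma (((m : ℝ) + 1) / 2) / Real.Gamma ((m : ℝ) / 2) ≤ √((m : ℝ) + 1) := by
    rw [div_le_iff₀ hG1, add_div]
    refine (gamma_add_half_le (by positivity)).trans ?_
    gcongr
    linarith
  have he : 1 ≤ √(Real.exp 1) := by
    rw [Real.one_le_sqrt]
    exact Real.one_le_exp zero_le_one
  have hs : 0 < √((m : ℝ) + 1) := by positivity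
  rw [lowerConst_eq (by omega), mul_comm, ← mul_assoc, mul_one_div_cancel hB.ne', one_mul]
  calc _ ≤ 2 / (1 * √((m : ℝ) + 1) * ((m : ℝ) + 1) ^ 2 * Real.pi) * ((m : ℝ) + 1) *
        √((m : ℝ) + 1) := by gcongr
    _ = 2 / (((m : ℝ) + 1) * Real.pi) := by field_simp
    _ ≤ 1 / 2 := by
      rw [div_le_div_iff₀ (by positivity) two_pos]
      nlinarith

/-- The Gamma function increases on `[2, ∞)`, so that `n! |B_2^n| ≥ π^(n/2)`. -/
theorem sqrt_two_pow_le_factorial_mul_ballVol {n : ℕ} (hn : 2 ≤ n) :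
    √2 ^ n ≤ n ! * ballVol n := by
  have hG : 0 < Real.Gamma ((n : ℝ) / 2 + 1) := Real.Gamma_pos_of_pos (by positivity)
  have hn' : (2 : ℝ) ≤ n := by exact_mod_cast hn
  have hle : Real.Gamma ((n : ℝ) / 2 + 1) ≤ n ! := by
    rw [← Real.Gamma_nat_eq_factorial]
    exact Real.Gamma_strictMonoOn_Ici.monotoneOn (mem_Ici.2 (by linarith))
      (mem_Ici.2 (by linarith)) (by linarith)
  rw [ballVol_eq (by omega), mul_div_assoc', le_div_iff₀ hG, mul_comm (n ! : ℝ)]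
  gcongr
  linarith [Real.pi_gt_three]

theorem lowerConst_mul_le_min {m : ℕ} (hm : 2 ≤ m) {t : ℝ} (ht : 0 ≤ t)
    (ht' : t ≤ ballVol (m + 1)) :
    lowerConst (m + 1) * t ≤ min ((m + 1)! * t / (2 * √2 ^ (m + 1))) (1 / 2) := by
  have hB := ballVol_pos (m + 1)
  have h1 := lowerConst_mul_ballVol_le hm
  have h2 := sqrt_two_pow_le_factorial_mul_ballVol (n := m + 1) (by omega)
  have h3 : lowerConst (m + 1) ≤ 1 / 2 / ballVol (m + 1) := (le_div_iff₀ hB).2 h1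
  have h4 : lowerConst (m + 1) * t ≤ 1 / 2 / ballVol (m + 1) * t := by gcongr
  refine h4.trans (le_min ?_ ?_)
  · have : 1 / 2 / ballVol (m + 1) ≤ (m + 1)! / (2 * √2 ^ (m + 1)) := by
      rw [div_le_div_iff₀ hB (by positivity)]
      linarith
    calc _ ≤ (m + 1)! / (2 * √2 ^ (m + 1)) * t := by gcongr
      _ = _ := by ring
  · rw [div_mul_eq_mul_div, div_le_iff₀ hB]
    linarith

/-! ### Random chords and triangles in the unit circle -/

theorem dist_sq_sphere {n : ℕ} (x y : sphere (0 : EuclideanSpace ℝ (Fin n)) 1) :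
    dist x y ^ 2 =
      2 - 2 * ⟪(x : EuclideanSpace ℝ (Fin n)), (y : EuclideanSpace ℝ (Fin n))⟫ := by
  rw [Subtype.dist_eq, dist_eq_norm, norm_sub_sq_real, norm_eq_of_mem_sphere,
    norm_eq_of_mem_sphere]
  ring

/-- The area of a triangle inscribed in the unit circle is a quarter of the product of its sides:
the three unit vectors are linearly dependent, so that their Gram determinant vanishes. -/
theorem simplexVol_two (x : Fin 3 → sphere (0 : EuclideanSpace ℝ (Fin 2)) 1) :
    simplexVol x = dist (x 0) (x 1) * dist (x 0) (x 2) * dist (x 1) (x 2) / 4 := by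
  rw [simplexVol_eq, ← sq_eq_sq₀ (by positivity) (by positivity)]
  simp only [div_pow, mul_pow, sq_abs, dist_sq_sphere]
  have hn : ∀ i, (x i : EuclideanSpace ℝ (Fin 2)) 0 ^ 2 +
      (x i : EuclideanSpace ℝ (Fin 2)) 1 ^ 2 = 1 := by
    intro i
    have h : ‖(x i : EuclideanSpace ℝ (Fin 2))‖ ^ 2 = 1 := by simp
    rwa [EuclideanSpace.real_norm_sq_eq, Fin.sum_univ_two] at h
  have h0 := hn 0
  have h1 := hn 1
  have h2 := hn 2
  simp only [Matrix.det_fin_two, rowMatrix_apply, Fin.succ_zero_eq_one, Fin.succ_one_eq_two,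
    PiLp.sub_apply, PiLp.inner_apply, Fin.sum_univ_two, RCLike.inner_apply, conj_trivial,
    Nat.factorial_two]
  generalize (x 0 : EuclideanSpace ℝ (Fin 2)) 0 = a0 at *
  generalize (x 0 : EuclideanSpace ℝ (Fin 2)) 1 = a1 at *
  generalize (x 1 : EuclideanSpace ℝ (Fin 2)) 0 = b0 at *
  generalize (x 1 : EuclideanSpace ℝ (Fin 2)) 1 = b1 at *
  generalize (x 2 : EuclideanSpace ℝ (Fin 2)) 0 = c0 at *
  generalize (x 2 : EuclideanSpace ℝ (Fin 2)) 1 = c1 at *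
  have hgram : 1 + 2 * (b0 * a0 + b1 * a1) * (c0 * a0 + c1 * a1) * (c0 * b0 + c1 * b1) -
      (b0 * a0 + b1 * a1) ^ 2 - (c0 * a0 + c1 * a1) ^ 2 - (c0 * b0 + c1 * b1) ^ 2 = 0 := by
    have h : (a0 ^ 2 + a1 ^ 2) * (b0 ^ 2 + b1 ^ 2) * (c0 ^ 2 + c1 ^ 2) +
        2 * (b0 * a0 + b1 * a1) * (c0 * a0 + c1 * a1) * (c0 * b0 + c1 * b1) -
        (c0 ^ 2 + c1 ^ 2) * (b0 * a0 + b1 * a1) ^ 2 -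
        (b0 ^ 2 + b1 ^ 2) * (c0 * a0 + c1 * a1) ^ 2 -
        (a0 ^ 2 + a1 ^ 2) * (c0 * b0 + c1 * b1) ^ 2 = 0 := by ring
    rw [h0, h1, h2] at h
    linear_combination h
  have hlagrange : ((b0 - a0) * (c1 - a1) - (b1 - a1) * (c0 - a0)) ^ 2 =
      (2 - 2 * (b0 * a0 + b1 * a1)) * (2 - 2 * (c0 * a0 + c1 * a1)) -
      ((c0 * b0 + c1 * b1) - (b0 * a0 + b1 * a1) - (c0 * a0 + c1 * a1) + 1) ^ 2 := by
    have e1 : 2 - 2 * (b0 * a0 + b1 * a1) = (b0 - a0) ^ 2 + (b1 - a1) ^ 2 := by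
      linear_combination -h0 - h1
    have e2 : 2 - 2 * (c0 * a0 + c1 * a1) = (c0 - a0) ^ 2 + (c1 - a1) ^ 2 := by
      linear_combination -h0 - h2
    have e3 : (c0 * b0 + c1 * b1) - (b0 * a0 + b1 * a1) - (c0 * a0 + c1 * a1) + 1 =
        (b0 - a0) * (c0 - a0) + (b1 - a1) * (c1 - a1) := by
      linear_combination -h0
    rw [e1, e2, e3]
    ring
  rw [hlagrange]
  push_cast
  linear_combination (1 / 4) * hgram

theorem sphereArea_one_div_two : sphereArea 1 / sphereArea (1 + 1) = 1 / Real.pi := by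
  have hπ := Real.pi_pos
  have hs := Real.sqrt_pos.2 hπ
  rw [sphereArea_eq_gamma le_rfl, sphereArea_eq_gamma (by omega)]
  norm_num
  rw [Real.Gamma_one_half_eq, Real.sq_sqrt hπ.le]
  field_simp

/-- The distribution of the length `q` of a random chord of the unit circle. -/
theorem uniformSphere_two_closedBall (x : sphere (0 : EuclideanSpace ℝ (Fin 2)) 1) {r : ℝ}
    (hr : 0 ≤ r) (hr2 : r < 2) :
    uniformSphere 2 (closedBall x r) = ENNReal.ofReal (1 / Real.pi) *
      ∫⁻ q in Ioc 0 r, ENNReal.ofReal (1 / √(1 - q ^ 2 / 4)) := by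
  have hset : closedBall x r = {y : sphere (0 : EuclideanSpace ℝ (Fin 2)) 1 |
      ⟪(y : EuclideanSpace ℝ (Fin 2)), (x : EuclideanSpace ℝ (Fin 2))⟫ ∈ Ici (1 - r ^ 2 / 2)} := by
    ext y
    rw [mem_closedBall, ← sq_le_sq₀ dist_nonneg hr, dist_sq_sphere, mem_ofPred_eq, mem_Ici]
    constructor <;> intro h <;> linarith
  have himage : Ici (1 - r ^ 2 / 2) ∩ Ioo (-1) 1 = (fun q : ℝ => 1 - q ^ 2 / 2) '' Ioc 0 r := by
    ext s
    constructor
    · rintro ⟨h1, h2, h3⟩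
      have h1 : 1 - r ^ 2 / 2 ≤ s := h1
      refine ⟨√(2 * (1 - s)), ⟨Real.sqrt_pos.2 (by linarith), ?_⟩, ?_⟩
      · rw [Real.sqrt_le_left hr]; linarith
      · simp only; rw [Real.sq_sqrt (by linarith)]; ring
    · rintro ⟨q, ⟨h1, h2⟩, rfl⟩
      refine ⟨?_, ?_, ?_⟩
      · simp only [mem_Ici]; nlinarith
      · simp only; nlinarith
      · simp only; nlinarith
  have hderiv : ∀ q ∈ Ioc (0 : ℝ) r,
      HasDerivWithinAt (fun q : ℝ => 1 - q ^ 2 / 2) (-q) (Ioc 0 r) q := by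
    intro q _
    have h := (((hasDerivAt_pow 2 q).div_const 2).const_sub 1).hasDerivWithinAt (s := Ioc 0 r)
    refine h.congr_deriv ?_
    norm_num
  have hinj : InjOn (fun q : ℝ => 1 - q ^ 2 / 2) (Ioc 0 r) := by
    intro p hp q hq h
    have h : p ^ 2 = q ^ 2 := by simp only at h; linarith
    exact (pow_left_inj₀ hp.1.le hq.1.le two_ne_zero).1 h
  rw [hset]
  refine (uniformSphere_inner_mem (m := 1) le_rfl (norm_eq_of_mem_sphere x)
    measurableSet_Ici).trans ?_
  rw [himage, lintegral_image_eq_lintegral_abs_deriv_mul measurableSet_Ioc hderiv hinj,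
    sphereArea_one_div_two]
  congr 1
  refine setLIntegral_congr_fun measurableSet_Ioc ?_
  rintro q ⟨h1, h2⟩
  have h3 : 0 < 1 - q ^ 2 / 4 := by nlinarith
  have h4 := Real.sqrt_pos.2 h3
  simp only
  rw [← ENNReal.ofReal_mul (abs_nonneg _), abs_neg, abs_of_pos h1]
  congr 1
  have e : 1 - (1 - q ^ 2 / 2) ^ 2 = (q * √(1 - q ^ 2 / 4)) ^ 2 := by
    rw [mul_pow, Real.sq_sqrt h3.le]; ring
  have e2 : (((1 : ℕ) : ℝ) - 2) / 2 = -(1 / 2) := by norm_num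
  rw [e, e2, Real.rpow_neg (by positivity), ← Real.sqrt_eq_rpow, Real.sqrt_sq (by positivity)]
  field_simp

theorem le_uniformSphere_two_closedBall (x : sphere (0 : EuclideanSpace ℝ (Fin 2)) 1) {r : ℝ}
    (hr : 0 ≤ r) (hr2 : r < 2) :
    ENNReal.ofReal (r / Real.pi) ≤ uniformSphere 2 (closedBall x r) := by
  have hπ := Real.pi_pos
  rw [uniformSphere_two_closedBall x hr hr2]
  calc ENNReal.ofReal (r / Real.pi) = ENNReal.ofReal (1 / Real.pi) * ∫⁻ q in Ioc 0 r, 1 := by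
        rw [setLIntegral_one, Real.volume_Ioc, sub_zero, ← ENNReal.ofReal_mul (by positivity),
          one_div_mul_eq_div]
    _ ≤ _ := by
        refine mul_le_mul' le_rfl (setLIntegral_mono (by fun_prop) fun q hq => ?_)
        have h3 : 0 < 1 - q ^ 2 / 4 := by nlinarith [hq.1, hq.2]
        rw [ENNReal.one_le_ofReal, one_le_div (Real.sqrt_pos.2 h3), Real.sqrt_le_left zero_le_one]
        nlinarith [sq_nonneg q]

theorem uniformSphere_two_closedBall_le (x : sphere (0 : EuclideanSpace ℝ (Fin 2)) 1) {r : ℝ}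
    (hr : 0 ≤ r) : uniformSphere 2 (closedBall x r) ≤ ENNReal.ofReal r := by
  have := isProbabilityMeasure_uniformSphere (n := 2) (by omega)
  have hπ := Real.pi_gt_three
  rcases le_or_gt 1 r with h1 | h1
  · exact prob_le_one.trans (ENNReal.one_le_ofReal.2 h1)
  rw [uniformSphere_two_closedBall x hr (by linarith)]
  calc _ ≤ ENNReal.ofReal (1 / Real.pi) * ∫⁻ q in Ioc 0 r, ENNReal.ofReal 2 := by
        refine mul_le_mul' le_rfl (setLIntegral_mono measurable_const fun q hq => ?_)
        have h3 : (1 / 2) ^ 2 ≤ 1 - q ^ 2 / 4 := by nlinarith [hq.1, hq.2]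
        have h4 : 1 / 2 ≤ √(1 - q ^ 2 / 4) := Real.le_sqrt_of_sq_le h3
        refine ENNReal.ofReal_le_ofReal ?_
        rw [div_le_iff₀ (by linarith)]
        linarith
    _ ≤ ENNReal.ofReal r := by
        rw [setLIntegral_const, Real.volume_Ioc, sub_zero, ← ENNReal.ofReal_mul zero_le_two,
          ← ENNReal.ofReal_mul (by positivity)]
        refine ENNReal.ofReal_le_ofReal ?_
        rw [one_div_mul_eq_div, div_le_iff₀ (by positivity)]
        nlinarith

/-- Conditionally on one of three independent points, the distances of the two others from it are
independent. -/
theorem pi_dist_le_dist_le {α : Type*} [PseudoMetricSpace α] [SecondCountableTopology α]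
    [MeasurableSpace α] [BorelSpace α] (σ : Measure α) [IsProbabilityMeasure σ] (i : Fin 3)
    (a b : ℝ) :
    Measure.pi (fun _ : Fin 3 => σ)
        {x | dist (x (i.succAbove 0)) (x i) ≤ a ∧ dist (x (i.succAbove 1)) (x i) ≤ b} =
      ∫⁻ y, σ (closedBall y a) * σ (closedBall y b) ∂σ := by
  have hpres := measurePreserving_piFinSuccAbove (fun _ : Fin 3 => σ) i
  have hmeas : MeasurableSet {p : α × (Fin 2 → α) | dist (p.2 0) p.1 ≤ a ∧ dist (p.2 1) p.1 ≤ b} :=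
    ((isClosed_le (f := fun p : α × (Fin 2 → α) => dist (p.2 0) p.1) (by fun_prop)
      continuous_const).inter (isClosed_le (f := fun p : α × (Fin 2 → α) => dist (p.2 1) p.1)
      (by fun_prop) continuous_const)).measurableSet
  have h := hpres.measure_preimage hmeas.nullMeasurableSet
  rw [Measure.prod_apply hmeas] at h
  refine Eq.trans ?_ (h.trans ?_)
  · rfl
  · refine lintegral_congr fun y => ?_
    have : Prod.mk y ⁻¹' {p : α × (Fin 2 → α) | dist (p.2 0) p.1 ≤ a ∧ dist (p.2 1) p.1 ≤ b} =
        Set.pi univ ![closedBall y a, closedBall y b] := by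
      ext v
      simp [Fin.forall_fin_two]
    rw [this, Measure.pi_pi, Fin.prod_univ_two]
    rfl

theorem le_pi_simplexVol_two {r : ℝ} (hr : 0 ≤ r) (hr2 : r < 2) :
    ENNReal.ofReal ((r / Real.pi) ^ 2) ≤
      Measure.pi (fun _ : Fin 3 => uniformSphere 2) {x | simplexVol x ≤ r ^ 3 / 2} := by
  have := isProbabilityMeasure_uniformSphere (n := 2) (by omega)
  have hπ := Real.pi_pos
  calc ENNReal.ofReal ((r / Real.pi) ^ 2)
      = ∫⁻ _, ENNReal.ofReal (r / Real.pi) * ENNReal.ofReal (r / Real.pi) ∂uniformSphere 2 := by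
        rw [lintegral_const, measure_univ, mul_one, ENNReal.ofReal_pow (by positivity), sq]
    _ ≤ ∫⁻ y, uniformSphere 2 (closedBall y r) * uniformSphere 2 (closedBall y r)
          ∂uniformSphere 2 :=
        lintegral_mono fun y => mul_le_mul' (le_uniformSphere_two_closedBall y hr hr2)
          (le_uniformSphere_two_closedBall y hr hr2)
    _ = _ := (pi_dist_le_dist_le (uniformSphere 2) 0 r r).symm
    _ ≤ _ := by
        refine measure_mono ?_
        rintro x ⟨h1, h2⟩
        have h1 : dist (x 1) (x 0) ≤ r := h1
        have h2 : dist (x 2) (x 0) ≤ r := h2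
        have h3 : dist (x 1) (x 2) ≤ 2 * r := by
          linarith [dist_triangle_right (x 1) (x 2) (x 0)]
        rw [mem_ofPred_eq, simplexVol_two, dist_comm (x 0) (x 1), dist_comm (x 0) (x 2)]
        calc _ ≤ r * r * (2 * r) / 4 := by gcongr
          _ = _ := by ring

/-- A dyadic decomposition in the length of the shorter side. -/
theorem eq_zero_or_dyadic_of_mul_sq_le {a b s : ℝ} (ha : 0 ≤ a) (hab : a ≤ b) (hs : 0 ≤ s)
    (h : a * b ^ 2 ≤ s ^ 3) :
    a = 0 ∨ ∃ k : ℕ, a ≤ (1 / 4) ^ k * s ∧ b ≤ 2 ^ (k + 1) * s := by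
  rcases ha.eq_or_lt with h0 | h0
  · exact .inl h0.symm
  right
  have has : a ≤ s := by
    refine le_of_pow_le_pow_left₀ three_ne_zero hs (le_trans ?_ h)
    nlinarith [mul_le_mul hab hab ha (by linarith)]
  have hs0 : 0 < s := by linarith
  obtain ⟨k, hk1, hk2⟩ := exists_nat_pow_near_of_lt_one (x := a / s) (y := 1 / 4)
    (by positivity) ((div_le_one hs0).2 has) (by norm_num) (by norm_num)
  rw [lt_div_iff₀ hs0] at hk1
  rw [div_le_iff₀ hs0] at hk2
  refine ⟨k, hk2, ?_⟩
  by_contra! hb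
  have hb2 : (2 ^ (k + 1) * s) ^ 2 < b ^ 2 := pow_lt_pow_left₀ hb (by positivity) two_ne_zero
  have : s ^ 3 < a * b ^ 2 := by
    calc s ^ 3 = ((1 / 4) ^ (k + 1) * s) * (2 ^ (k + 1) * s) ^ 2 := by
          have : (1 / 4 : ℝ) ^ (k + 1) * (2 ^ (k + 1)) ^ 2 = 1 := by
            rw [← pow_mul, mul_comm (k + 1), pow_mul, ← mul_pow]; norm_num
          linear_combination (-s ^ 3) * this
      _ < a * b ^ 2 := by gcongr
  linarith

/-- The two shorter sides of a thin triangle, with common endpoint `x i`; for `j : Fin 2`, `1 - j`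
is the other index. -/
theorem pi_dist_mul_dist_sq_le (i : Fin 3) (j : Fin 2) {s : ℝ} (hs : 0 ≤ s) :
    Measure.pi (fun _ : Fin 3 => uniformSphere 2)
        {x | dist (x (i.succAbove j)) (x i) ≤ dist (x (i.succAbove (1 - j))) (x i) ∧
          dist (x (i.succAbove j)) (x i) * dist (x (i.succAbove (1 - j))) (x i) ^ 2 ≤ s ^ 3} ≤
      ENNReal.ofReal (4 * s ^ 2) := by
  have := isProbabilityMeasure_uniformSphere (n := 2) (by omega)
  have hpair : ∀ a b : ℝ, 0 ≤ a → 0 ≤ b → Measure.pi (fun _ : Fin 3 => uniformSphere 2)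
      {x | dist (x (i.succAbove j)) (x i) ≤ a ∧ dist (x (i.succAbove (1 - j))) (x i) ≤ b} ≤
      ENNReal.ofReal (a * b) := by
    intro a b ha hb
    have hle : ∫⁻ y, uniformSphere 2 (closedBall y a) * uniformSphere 2 (closedBall y b)
        ∂uniformSphere 2 ≤ ENNReal.ofReal (a * b) := by
      calc _ ≤ ∫⁻ _, ENNReal.ofReal a * ENNReal.ofReal b ∂uniformSphere 2 :=
            lintegral_mono fun y => mul_le_mul' (uniformSphere_two_closedBall_le y ha)
              (uniformSphere_two_closedBall_le y hb)
        _ = _ := by rw [lintegral_const, measure_univ, mul_one, ENNReal.ofReal_mul ha]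
    fin_cases j
    · exact (pi_dist_le_dist_le (uniformSphere 2) i a b).trans_le hle
    · have h := pi_dist_le_dist_le (uniformSphere 2) i b a
      simp only [mul_comm (uniformSphere 2 (closedBall _ b)), and_comm (b := _ ≤ a)] at h
      exact h.trans_le hle
  have hcover : {x : Fin 3 → sphere (0 : EuclideanSpace ℝ (Fin 2)) 1 |
      dist (x (i.succAbove j)) (x i) ≤ dist (x (i.succAbove (1 - j))) (x i) ∧
        dist (x (i.succAbove j)) (x i) * dist (x (i.succAbove (1 - j))) (x i) ^ 2 ≤ s ^ 3} ⊆
      {x | dist (x (i.succAbove j)) (x i) ≤ 0 ∧ dist (x (i.succAbove (1 - j))) (x i) ≤ 2} ∪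
      ⋃ k : ℕ, {x | dist (x (i.succAbove j)) (x i) ≤ (1 / 4) ^ k * s ∧
        dist (x (i.succAbove (1 - j))) (x i) ≤ 2 ^ (k + 1) * s} := by
    rintro x ⟨h1, h2⟩
    rcases eq_zero_or_dyadic_of_mul_sq_le dist_nonneg h1 hs h2 with h | ⟨k, hk⟩
    · refine .inl ⟨h.le, ?_⟩
      have h3 := dist_triangle_right (x (i.succAbove (1 - j)) : EuclideanSpace ℝ (Fin 2)) (x i) 0
      rw [dist_zero_right, dist_zero_right, norm_eq_of_mem_sphere, norm_eq_of_mem_sphere] at h3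
      rw [Subtype.dist_eq]
      linarith
    · exact .inr (mem_iUnion.2 ⟨k, hk⟩)
  refine (measure_mono hcover).trans ((measure_union_le _ _).trans ?_)
  have h0 := hpair 0 2 le_rfl zero_le_two
  rw [zero_mul, ENNReal.ofReal_zero, nonpos_iff_eq_zero] at h0
  rw [h0, zero_add]
  refine (measure_iUnion_le _).trans ?_
  calc _ ≤ ∑' k : ℕ, ENNReal.ofReal (2 * s ^ 2 * (1 / 2) ^ k) := by
        refine ENNReal.tsum_le_tsum fun k => ?_
        refine (hpair _ _ (by positivity) (by positivity)).trans_eq ?_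
        congr 1
        have : (1 / 4 : ℝ) ^ k * 2 ^ k = (1 / 2) ^ k := by rw [← mul_pow]; norm_num
        linear_combination (2 * s ^ 2) * this
    _ = ENNReal.ofReal (4 * s ^ 2) := by
        rw [← ENNReal.ofReal_tsum_of_nonneg (fun k => by positivity)
          (summable_geometric_two.mul_left _), tsum_mul_left, tsum_geometric_two]
        ring_nf

theorem pi_simplexVol_two_le {s : ℝ} (hs : 0 ≤ s) :
    Measure.pi (fun _ : Fin 3 => uniformSphere 2) {x | simplexVol x ≤ s ^ 3 / 4} ≤
      ENNReal.ofReal (24 * s ^ 2) := by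
  -- the vertex `i` is the common endpoint of the two shorter sides; `i.succAbove j` is the other
  -- endpoint of the shortest one
  have hcover : {x : Fin 3 → sphere (0 : EuclideanSpace ℝ (Fin 2)) 1 |
      simplexVol x ≤ s ^ 3 / 4} ⊆ ⋃ p : Fin 3 × Fin 2,
      {x | dist (x (p.1.succAbove p.2)) (x p.1) ≤ dist (x (p.1.succAbove (1 - p.2))) (x p.1) ∧
        dist (x (p.1.succAbove p.2)) (x p.1) * dist (x (p.1.succAbove (1 - p.2))) (x p.1) ^ 2 ≤
          s ^ 3} := by
    intro x hx
    rw [mem_ofPred_eq, simplexVol_two, div_le_div_iff_of_pos_right four_pos] at hx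
    have key : ∀ a b c : ℝ, 0 ≤ a → a ≤ b → b ≤ c → a * b * c ≤ s ^ 3 → a ≤ b ∧ a * b ^ 2 ≤ s ^ 3 :=
      fun a b c ha hab hbc h => ⟨hab, by nlinarith [mul_nonneg ha (ha.trans hab)]⟩
    have h01 := dist_nonneg (x := x 0) (y := x 1)
    have h02 := dist_nonneg (x := x 0) (y := x 2)
    have h12 := dist_nonneg (x := x 1) (y := x 2)
    have c01 := dist_comm (x 0) (x 1)
    have c02 := dist_comm (x 0) (x 2)
    have c12 := dist_comm (x 1) (x 2)
    rw [mem_iUnion]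
    rcases le_total (dist (x 0) (x 1)) (dist (x 0) (x 2)) with h1 | h1 <;>
    rcases le_total (dist (x 0) (x 1)) (dist (x 1) (x 2)) with h2 | h2 <;>
    rcases le_total (dist (x 0) (x 2)) (dist (x 1) (x 2)) with h3 | h3
    · exact ⟨(0, 0), by have := key _ _ _ h01 h1 h3 (by linarith); rwa [c01, c02] at this⟩
    · exact ⟨(1, 0), by have := key _ _ _ h01 h2 h3 (by linarith); rwa [c12] at this⟩
    · exact ⟨(0, 0), by have := key _ _ _ h01 h1 h3 (by linarith); rwa [c01, c02] at this⟩
    · exact ⟨(1, 1), by have := key _ _ _ h12 h2 h1 (by linarith); rwa [c12] at this⟩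
    · exact ⟨(0, 1), by have := key _ _ _ h02 h1 h2 (by linarith); rwa [c01, c02] at this⟩
    · exact ⟨(2, 1), by have := key _ _ _ h12 h3 h1 (by linarith); exact this⟩
    · exact ⟨(2, 0), by have := key _ _ _ h02 h3 h2 (by linarith); exact this⟩
    · exact ⟨(2, 1), by have := key _ _ _ h12 h3 h1 (by linarith); exact this⟩
  refine (measure_mono hcover).trans ((measure_iUnion_fintype_le _ _).trans ?_)
  calc _ ≤ ∑ p : Fin 3 × Fin 2, ENNReal.ofReal (4 * s ^ 2) :=
        Finset.sum_le_sum fun p _ => pi_dist_mul_dist_sq_le p.1 p.2 hs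
    _ = ENNReal.ofReal (24 * s ^ 2) := by
        rw [Finset.sum_const, Finset.card_univ, nsmul_eq_mul, ← ENNReal.ofReal_natCast,
          ← ENNReal.ofReal_mul (by positivity)]
        congr 1
        norm_num
        ring

/-! ### The distribution of the volume -/

theorem lemma14 (n : ℕ) {Ω : Type*} [MeasurableSpace Ω] (P : Measure Ω) [IsProbabilityMeasure P]
    (ξ : Fin (n + 1) → Ω → Metric.sphere (0 : EuclideanSpace ℝ (Fin n)) 1)
    (hunif : ∀ i, HasLaw (ξ i) (uniformSphere n) P)
    (hindep : iIndepFun ξ P) :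
    (n = 2 →
      (∀ t : ℝ, 0 ≤ t → t ≤ Real.pi →
        (2 * t) ^ (2 / 3 : ℝ) / Real.pi ^ (8 / 3 : ℝ)
          ≤ P.real {ω | simplexVol (fun i => ξ i ω) ≤ t}) ∧
      (∀ t : ℝ, 0 ≤ t →
        P.real {ω | simplexVol (fun i => ξ i ω) ≤ t} ≤ 342 * t ^ (2 / 3 : ℝ))) ∧
    (3 ≤ n →
      (∀ t : ℝ, 0 ≤ t → t ≤ ballVol n →
        lowerConst n * t ≤ P.real {ω | simplexVol (fun i => ξ i ω) ≤ t}) ∧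
      (∀ t : ℝ, 0 ≤ t →
        P.real {ω | simplexVol (fun i => ξ i ω) ≤ t} ≤ upperConst n * t)) := by
  have hlaw : 1 ≤ n → ∀ t : ℝ, P {ω | simplexVol (fun i => ξ i ω) ≤ t} =
      Measure.pi (fun _ : Fin (n + 1) => uniformSphere n) {x | simplexVol x ≤ t} := by
    intro hn t
    have := isProbabilityMeasure_uniformSphere hn
    have h := hindep.hasLaw_pi hunif
    rw [← h.map_eq, Measure.map_apply_of_aemeasurable h.aemeasurable
      (measurableSet_le (measurable_simplexVol n) measurable_const)]
    rfl
  have hlower : ∀ {c t : ℝ}, 1 ≤ n →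
      ENNReal.ofReal c ≤
        Measure.pi (fun _ : Fin (n + 1) => uniformSphere n) {x | simplexVol x ≤ t} →
      c ≤ P.real {ω | simplexVol (fun i => ξ i ω) ≤ t} := by
    intro c t hn h
    rw [← hlaw hn] at h
    exact (ENNReal.ofReal_le_iff_le_toReal (measure_ne_top _ _)).1 h
  have hupper : ∀ {c t : ℝ}, 1 ≤ n → 0 ≤ c →
      Measure.pi (fun _ : Fin (n + 1) => uniformSphere n) {x | simplexVol x ≤ t} ≤
        ENNReal.ofReal c →
      P.real {ω | simplexVol (fun i => ξ i ω) ≤ t} ≤ c := by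
    intro c t hn hc h
    rw [← hlaw hn] at h
    exact ENNReal.toReal_le_of_le_ofReal hc h
  have hcube : ∀ {x : ℝ}, 0 ≤ x → (x ^ (1 / 3 : ℝ)) ^ 3 = x ∧
      (x ^ (1 / 3 : ℝ)) ^ 2 = x ^ (2 / 3 : ℝ) := by
    intro x hx
    rw [← Real.rpow_natCast, ← Real.rpow_natCast, ← Real.rpow_mul hx, ← Real.rpow_mul hx]
    norm_num
  refine ⟨?_, fun hn => ?_⟩
  · rintro rfl
    have hπ := Real.pi_pos
    refine ⟨fun t ht htπ => ?_, fun t ht => ?_⟩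
    · obtain ⟨h3, h2⟩ := hcube (x := 2 * t) (by positivity)
      set r := (2 * t) ^ (1 / 3 : ℝ) with hr
      have hr0 : 0 ≤ r := by positivity
      have hr2 : r < 2 := by
        refine lt_of_pow_lt_pow_left₀ 3 zero_le_two ?_
        rw [h3]
        linarith [Real.pi_lt_four]
      have hmain := hlower (by omega) (le_pi_simplexVol_two hr0 hr2)
      have hvol : r ^ 3 / 2 = t := by rw [h3]; ring
      rw [hvol] at hmain
      refine le_trans ?_ hmain
      rw [div_pow, h2]
      gcongr
      rw [← Real.rpow_natCast]
      exact Real.rpow_le_rpow_of_exponent_le (by linarith [Real.pi_gt_three]) (by norm_num)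
    · obtain ⟨h3, h2⟩ := hcube (x := 4 * t) (by positivity)
      set s := (4 * t) ^ (1 / 3 : ℝ) with hs
      have hs0 : 0 ≤ s := by positivity
      have hvol : s ^ 3 / 4 = t := by rw [h3]; ring
      have hmain := pi_simplexVol_two_le hs0
      rw [hvol] at hmain
      refine (hupper (by omega) (by positivity) hmain).trans ?_
      have h4 : (4 : ℝ) ^ (2 / 3 : ℝ) ≤ 4 := by
        calc (4 : ℝ) ^ (2 / 3 : ℝ) ≤ 4 ^ (1 : ℝ) :=
              Real.rpow_le_rpow_of_exponent_le (by norm_num) (by norm_num)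
          _ = 4 := Real.rpow_one 4
      have h5 : 0 ≤ t ^ (2 / 3 : ℝ) := by positivity
      rw [h2, Real.mul_rpow (by norm_num) ht]
      nlinarith
  · obtain ⟨m, rfl⟩ : ∃ m, n = m + 1 := ⟨n - 1, by omega⟩
    have hm : 2 ≤ m := by omega
    refine ⟨fun t ht htB => ?_, fun t ht => ?_⟩
    · exact (lowerConst_mul_le_min hm ht htB).trans
        (hlower (by omega) (min_le_pi_simplexVol_le hm ht))
    · refine hupper (by omega) (mul_nonneg ?_ ht) (pi_simplexVol_le_upper hm ht)
      have hβ : 0 < beta (1 / 2) ((((m + 1 : ℕ) : ℝ) ^ 2 - 3 * ((m + 1 : ℕ) : ℝ) + 2) / 2) := by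
        have : (2 : ℝ) ≤ m := by exact_mod_cast hm
        refine beta_pos (by norm_num) ?_
        push_cast
        nlinarith
      have h1 := sphereArea_nonneg (m + 1 - 1)
      have h2 := sphereArea_nonneg (m + 1)
      rw [upperConst]
      positivity
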